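/- Let $Q$ be a smooth manifold of dimension $n\ge 1$ with a smooth (pseudo-)Riemannian metric $\mathbf g$, let $V,G:Q\to\mathbb R$ be smooth, let $m\ge 1$ be an integer and $c\in\mathbb R$. Let $L=\tfrac12 g^{ij}p_ip_j+V(q^i)$ be the natural Hamiltonian on $T^*Q$ with canonical coordinates $(q^i,p_i)$ and $X_L$ its Hamiltonian vector field. We say that $L$ admits an extension with first integral $U^m(G)$ if there are a nonempty open interval $N\subseteq\mathbb R$ and smooth functions $\alpha,f,\gamma$ on $N$, with $\alpha$ not identically zero, such that, with $$H=\tfrac12p_u^2+\alpha(u)L+f(u),\qquad U=p_u+\gamma(u)X_L ,$$ one has $X_H\big(U^m(G)\big)=0$ on $T^*N\times T^*Q$, where $(u,p_u)$ are the canonical coordinates on $T^*N$ and $U^m(G)$ is obtained by applying $U$ to $G=G(q^i)$ $m$ times. Consider the equation $$\mathbf H(G)+mc\,\mathbf g\,G=\mathbf 0,\qquad \mathbf H(G)_{ij}=\nabla_i\nabla_jG. \tag{1}$$ In terms of $z_k=\partial_kG/G$ it is the first order system $\partial_iz_j=P_{ij}(q,z):=-z_iz_j+\Gamma^k_{ij}z_k-mc\,g_{ij}$.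 Its integrability conditions are $\partial_iP_{jl}-\partial_jP_{il}=0$ for all $i,j,l$, identically in $(q,z)$, where the derivatives are computed by considering the $z_k$ as functions of $q$ and replacing $\partial_iz_k$ by $P_{ik}(q,z)$. A complete solution of (1) is a solution $G$ of (1) when these integrability conditions are satisfied. Then the following are equivalent: (a) $L$ admits an extension with first integral $U^m(G)$, and $G$ is a complete solution of (1); (b) $Q$ has constant curvature $K=mc$, that is, $R_{hlij}=mc\,(g_{jl}g_{hi}-g_{il}g_{hj})$ (a void condition if $n=1$), $G$ is a solution of (1), and there is $L_0\in\mathbb R$ with $$\nabla V\cdot\nabla G-2m(cV+L_0)G=0.$$ -/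

import Mathlib

open scoped Manifold ContDiff Bundle

noncomputable section

namespace ExtHam

/-- Coordinate space `ℝⁿ`. -/
abbrev E (n : ℕ) : Type := EuclideanSpace ℝ (Fin n)

/-- Partial derivative `∂ᵢ f (x)`. -/
def pd {n : ℕ} (i : Fin n) (f : E n → ℝ) (x : E n) : ℝ :=
  fderiv ℝ f x (EuclideanSpace.single i 1)

/-- A smooth (pseudo-)Riemannian metric on an `n`-dimensional manifold `Q`: a smooth field of
symmetric nondegenerate bilinear forms on the tangent spaces, of any signature. -/
structure PseudoRiemannianMetric (n : ℕ) (Q : Type*) [TopologicalSpace Q] [ChartedSpace (E n) Q]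
    [IsManifold (𝓡 n) ∞ Q] where
  val (x : Q) : TangentSpace (𝓡 n) x →L[ℝ] TangentSpace (𝓡 n) x →L[ℝ] ℝ
  symm (x : Q) (v w : TangentSpace (𝓡 n) x) : val x v w = val x w v
  nondegenerate (x : Q) (v : TangentSpace (𝓡 n) x) (hv : ∀ w, val x v w = 0) : v = 0
  contMDiff : ContMDiff (𝓡 n) ((𝓡 n).prod 𝓘(ℝ, E n →L[ℝ] E n →L[ℝ] ℝ)) ∞
    (fun x ↦ Bundle.TotalSpace.mk' (E n →L[ℝ] E n →L[ℝ] ℝ) x (val x))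

/-! ### Local coordinate expressions

`e` is a chart of `Q`; the coordinates `q = (q¹, …, qⁿ)` range over the open set `e.target`. -/

section Coordinates

variable {n : ℕ} {Q : Type*} [TopologicalSpace Q] [ChartedSpace (E n) Q]

/-- The smooth charts of `Q` (the maximal atlas). -/
def charts (n : ℕ) (Q : Type*) [TopologicalSpace Q] [ChartedSpace (E n) Q] :
    Set (OpenPartialHomeomorph Q (E n)) :=
  IsManifold.maximalAtlas (𝓡 n) ∞ Q

/-- The coordinate vector `∂/∂qⁱ`, a tangent vector at the point with coordinates `q`. -/
def coordVec (e : OpenPartialHomeomorph Q (E n)) (q : E n) (i : Fin n) :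
    TangentSpace (𝓡 n) (e.symm q) :=
  mfderiv (𝓡 n) (𝓡 n) e.symm q (EuclideanSpace.single i (1 : ℝ) : E n)

/-- Coordinate expression of a function on `Q`. -/
def rep (e : OpenPartialHomeomorph Q (E n)) (G : Q → ℝ) : E n → ℝ := fun q ↦ G (e.symm q)

variable [IsManifold (𝓡 n) ∞ Q] (g : PseudoRiemannianMetric n Q)
  (e : OpenPartialHomeomorph Q (E n))

/-- The matrix `g_{ij}` of the metric. -/
def gLow (q : E n) : Matrix (Fin n) (Fin n) ℝ :=
  Matrix.of fun i j ↦ g.val (e.symm q) (coordVec e q i) (coordVec e q j)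

/-- The inverse matrix `g^{ij}`. -/
def gUp (q : E n) : Matrix (Fin n) (Fin n) ℝ := (gLow g e q)⁻¹

/-- The Christoffel symbol `Γ^k_{ij}` of the Levi-Civita connection. -/
def christoffel (k i j : Fin n) (q : E n) : ℝ :=
  (1 / 2) * ∑ l, gUp g e q k l *
    (pd i (fun x ↦ gLow g e x j l) q + pd j (fun x ↦ gLow g e x i l) q
      - pd l (fun x ↦ gLow g e x i j) q)

/-- The Riemann tensor
`R^k_{lij} = ∂ᵢ Γ^k_{jl} - ∂ⱼ Γ^k_{il} + Γ^h_{jl} Γ^k_{ih} - Γ^h_{il} Γ^k_{jh}`. -/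
def riemann (k l i j : Fin n) (q : E n) : ℝ :=
  pd i (christoffel g e k j l) q - pd j (christoffel g e k i l) q
    + ∑ h, (christoffel g e h j l q * christoffel g e k i h q
      - christoffel g e h i l q * christoffel g e k j h q)

/-- The Riemann tensor with all indices down, `R_{hlij} = g_{hk} R^k_{lij}`. -/
def riemannLow (h l i j : Fin n) (q : E n) : ℝ :=
  ∑ k, gLow g e q h k * riemann g e k l i j q

/-- The Hessian tensor `H(G)_{ij} = ∇ᵢ∇ⱼ G = ∂ᵢ∂ⱼ G - Γ^k_{ij} ∂ₖ G`. -/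
def hessian (G : Q → ℝ) (i j : Fin n) (q : E n) : ℝ :=
  pd i (pd j (rep e G)) q - ∑ k, christoffel g e k i j q * pd k (rep e G) q

/-- The scalar product of gradients `∇V · ∇G = g^{ij} ∂ᵢV ∂ⱼG`. -/
def gradDot (V G : Q → ℝ) (q : E n) : ℝ :=
  ∑ i, ∑ j, gUp g e q i j * pd i (rep e V) q * pd j (rep e G) q

/-- The natural Hamiltonian `L = ½ g^{ij} pᵢ pⱼ + V` on `T*Q` in canonical coordinates `(q, p)`. -/
def natHam (V : Q → ℝ) : E n → E n → ℝ := fun q p ↦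
  (1 / 2) * (∑ i, ∑ j, gUp g e q i j * p i * p j) + rep e V q

/-- The right-hand side
`P_{ij}(q, z) = -zᵢ zⱼ + Γ^k_{ij}(q) zₖ - K g_{ij}(q)` of the first order system
`∂ᵢ zⱼ = P_{ij}(q, z)` to which the equation `∇ᵢ∇ⱼ G + K g_{ij} G = 0` is equivalent
under `zₖ = ∂ₖ G / G`. -/
def pfaffRHS (K : ℝ) (i j : Fin n) (q z : E n) : ℝ :=
  -(z i * z j) + ∑ k, christoffel g e k i j q * z k - K * gLow g e q i j

/-- The derivative of `P_{jl}(q, z)` with respect to `qⁱ` in which the `zₖ` are considered as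
functions of `q` that satisfy the system, that is, with `∂ᵢ zₖ` replaced by `P_{ik}(q, z)`. -/
def pfaffTotalDeriv (K : ℝ) (i j l : Fin n) (q z : E n) : ℝ :=
  pd i (fun x ↦ pfaffRHS g e K j l x z) q
    + ∑ k, pd k (fun w ↦ pfaffRHS g e K j l q w) z * pfaffRHS g e K i k q z

end Coordinates

/-! ### Hamiltonian vector fields and the operator `U` in canonical coordinates -/

section Hamiltonian

variable {n : ℕ}

/-- The Hamiltonian vector field of `L(q, p)`, acting on functions of `(q, p)`:
`X_L F = ∂L/∂pᵢ ∂F/∂qⁱ - ∂L/∂qⁱ ∂F/∂pᵢ`. -/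
def hamField (L F : E n → E n → ℝ) : E n → E n → ℝ := fun q p ↦
  ∑ i, (pd i (fun y ↦ L q y) p * pd i (fun x ↦ F x p) q
    - pd i (fun x ↦ L x p) q * pd i (fun y ↦ F q y) p)

/-- The Hamiltonian vector field of `H(u, p_u, q, p)`, acting on functions of `(u, p_u, q, p)`. -/
def hamFieldExt (H F : ℝ → ℝ → E n → E n → ℝ) : ℝ → ℝ → E n → E n → ℝ := fun u pu q p ↦
  deriv (fun t ↦ H u t q p) pu * deriv (fun t ↦ F t pu q p) u
    - deriv (fun t ↦ H t pu q p) u * deriv (fun t ↦ F u t q p) pu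
    + hamField (H u pu) (F u pu) q p

/-- The extended Hamiltonian `H = ½ p_u² + α(u) L + f(u)`. -/
def extHam (L : E n → E n → ℝ) (α f : ℝ → ℝ) : ℝ → ℝ → E n → E n → ℝ := fun u pu q p ↦
  (1 / 2) * pu ^ 2 + α u * L q p + f u

/-- The operator `U = p_u + γ(u) X_L`. -/
def opU (L : E n → E n → ℝ) (γ : ℝ → ℝ) (F : ℝ → ℝ → E n → E n → ℝ) :
    ℝ → ℝ → E n → E n → ℝ := fun u pu q p ↦
  pu * F u pu q p + γ u * hamField L (F u pu) q p

/-- The function `U^m(G)` for a function `G(q)` that does not depend on `u, p_u, p`. -/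
def powU (L : E n → E n → ℝ) (γ : ℝ → ℝ) (m : ℕ) (G : E n → ℝ) : ℝ → ℝ → E n → E n → ℝ :=
  (opU L γ)^[m] (fun _ _ q _ ↦ G q)

end Hamiltonian

section Main

variable {n : ℕ} {Q : Type*} [TopologicalSpace Q] [ChartedSpace (E n) Q]
  [IsManifold (𝓡 n) ∞ Q]

/-- `U^m(G)` is a first integral of the extension `H = ½ p_u² + α(u) L + f(u)` of
`L = ½ g^{ij} pᵢ pⱼ + V`: `X_H (U^m(G)) = 0` on `T*N × T*Q`, in the canonical coordinates
`(u, p_u, q, p)` of every chart. -/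
def IsFirstIntegralPowU (g : PseudoRiemannianMetric n Q) (V : Q → ℝ) (m : ℕ) (G : Q → ℝ)
    (N : Set ℝ) (α f γ : ℝ → ℝ) : Prop :=
  ∀ e ∈ charts n Q, ∀ u ∈ N, ∀ pu : ℝ, ∀ q ∈ e.target, ∀ p : E n,
    hamFieldExt (extHam (natHam g e V) α f) (powU (natHam g e V) γ m (rep e G)) u pu q p = 0

/-- `L = ½ g^{ij} pᵢ pⱼ + V` admits an extension `H = ½ p_u² + α(u) L + f(u)`, over a nonempty open
interval `N` and with `α` not identically zero, for which `U^m(G)`, `U = p_u + γ(u) X_L`, is a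
first integral. -/
def AdmitsExtension (g : PseudoRiemannianMetric n Q) (V : Q → ℝ) (m : ℕ) (G : Q → ℝ) : Prop :=
  ∃ (N : Set ℝ) (α f γ : ℝ → ℝ),
    IsOpen N ∧ N.Nonempty ∧ IsPreconnected N ∧
    ContDiffOn ℝ ∞ α N ∧ ContDiffOn ℝ ∞ f N ∧ ContDiffOn ℝ ∞ γ N ∧
    (∃ u ∈ N, α u ≠ 0) ∧
    IsFirstIntegralPowU g V m G N α f γ

/-- `G` satisfies the equation `H(G) + K g G = 0`. -/
def SolvesHessianEq (g : PseudoRiemannianMetric n Q) (K : ℝ) (G : Q → ℝ) : Prop :=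
  ∀ e ∈ charts n Q, ∀ q ∈ e.target, ∀ i j : Fin n,
    hessian g e G i j q + K * gLow g e q i j * G (e.symm q) = 0

/-- The integrability conditions of the equation `H(G) + K g G = 0`: the first order system
`∂ᵢ zⱼ = P_{ij}(q, z)` for `zₖ = ∂ₖ G / G` satisfies `∂ᵢ P_{jl} - ∂ⱼ P_{il} = 0` identically in
`(q, z)`, the `zₖ` being differentiated as functions of `q` by means of the system. -/
def HessianEqIntegrable (g : PseudoRiemannianMetric n Q) (K : ℝ) : Prop :=
  ∀ e ∈ charts n Q, ∀ q ∈ e.target, ∀ z : E n, ∀ i j l : Fin n,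
    pfaffTotalDeriv g e K i j l q z - pfaffTotalDeriv g e K j i l q z = 0

/-- `G` is a complete solution of `H(G) + K g G = 0`: a solution of an equation of this form whose
integrability conditions are satisfied. -/
def IsCompleteSolution (g : PseudoRiemannianMetric n Q) (K : ℝ) (G : Q → ℝ) : Prop :=
  SolvesHessianEq g K G ∧ HessianEqIntegrable g K

/-- Constant curvature `K`: `R_{hlij} = K (g_{jl} g_{hi} - g_{il} g_{hj})`. -/
def HasConstantCurvature (g : PseudoRiemannianMetric n Q) (K : ℝ) : Prop :=
  ∀ e ∈ charts n Q, ∀ q ∈ e.target, ∀ h l i j : Fin n,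
    riemannLow g e h l i j q =
      K * (gLow g e q j l * gLow g e q h i - gLow g e q i l * gLow g e q h j)

/-- The potential condition `∇V · ∇G - 2m(cV + L₀)G = 0`. -/
def PotentialCondition (g : PseudoRiemannianMetric n Q) (V : Q → ℝ) (m : ℕ) (c L₀ : ℝ)
    (G : Q → ℝ) : Prop :=
  ∀ e ∈ charts n Q, ∀ q ∈ e.target,
    gradDot g e V G q - 2 * m * (c * V (e.symm q) + L₀) * G (e.symm q) = 0

end Main

end ExtHam

end

/-!
Write `X` for `X_L`. Since `X_L L = 0`, the commutator of `X_H` with `U = p_u + γ X` is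
`[X_H, U] = p_u γ' X - (α' L + f')`, which commutes with `U`. Hence

  `X_H (Uᵐ G) = Uᵐ⁻¹ ((α + mγ') p_u X G + αγ X² G - m (α' L + f') G)`

(`hamFieldExt_powU`). Here `Uᵐ G` is encoded as the value of the polynomial `(p_u + γ S)ᵐ` in the
shift `S` on the sequence `k ↦ Xᵏ G` (`binShift`, `powU_eq_binShift`). The two leading coefficients
in `p_u` show that `X_H (Uᵐ G) = 0` implies `(α + mγ') X G = 0` and, when `α + mγ' = 0`,
`αγ X² G = m (α' L + f') G` (`leading_coeffs_eq_zero`); conversely these two equations are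
sufficient.

In coordinates `X² G = vⁱ vʲ ∇ᵢ∇ⱼ G - ∇V · ∇G` with the velocity `vⁱ = g^{ij} pⱼ`, so that on a
solution of `∇∇G + mc g G = 0` one has `X² G = -2mc (L - V) G - ∇V · ∇G`
(`hamField_hamField_of_solvesHessianEq`). The second equation is then affine in the kinetic energy:

* given an extension with `X G ≠ 0` somewhere, `α = -mγ'` and `α ≢ 0` give a point `u₀` with
  `α γ ≠ 0`; a momentum with nonzero kinetic energy gives `α' = -2cαγ` at `u₀`, and what remains is
  the potential condition with `L₀ = -f'/(2αγ)` at `u₀`. If `X G = 0` everywhere, then `mc G = 0`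
  and `L₀ = 0` works (`exists_potentialCondition_of_admitsExtension`);
* conversely the potential condition makes any solution of `γ' = -α/m`, `α' = -2cαγ`,
  `f' = -2L₀αγ` an extension, and these equations have explicit solutions on `u > 0`
  (`admitsExtension_of_potentialCondition`).

Finally the integrability conditions of the system `∂ᵢ zⱼ = P_{ij}` are linear in `z`, with
coefficients `R^k_{lij} - K (g_{jl} δ^k_i - g_{il} δ^k_j)`, so they hold identically in `z` exactly
when the curvature is constant and equal to `K` (`hessianEqIntegrable_iff`).
-/

namespace ExtHam

/-! ### Partial derivatives and the Hamiltonian vector field -/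

section PartialDerivatives

variable {n : ℕ} {i : Fin n} {f h : E n → ℝ} {x : E n}

lemma pd_congr_of_eqOn {s : Set (E n)} (hs : IsOpen s) (hx : x ∈ s) (H : Set.EqOn f h s) :
    pd i f x = pd i h x := by
  unfold pd
  rw [(H.eventuallyEq_of_mem (hs.mem_nhds hx)).fderiv_eq]

@[simp] lemma pd_const (a : ℝ) : pd i (fun _ : E n ↦ a) x = 0 := by
  simp [pd]

lemma pd_add (hf : DifferentiableAt ℝ f x) (hh : DifferentiableAt ℝ h x) :
    pd i (fun y ↦ f y + h y) x = pd i f x + pd i h x := by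
  unfold pd
  rw [fderiv_fun_add hf hh]; rfl

lemma pd_sub (hf : DifferentiableAt ℝ f x) (hh : DifferentiableAt ℝ h x) :
    pd i (fun y ↦ f y - h y) x = pd i f x - pd i h x := by
  unfold pd
  rw [fderiv_fun_sub hf hh]; rfl

lemma pd_mul (hf : DifferentiableAt ℝ f x) (hh : DifferentiableAt ℝ h x) :
    pd i (fun y ↦ f y * h y) x = pd i f x * h x + f x * pd i h x := by
  unfold pd
  rw [fderiv_fun_mul hf hh]
  simp
  ring

lemma pd_const_mul (a : ℝ) (hf : DifferentiableAt ℝ f x) :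
    pd i (fun y ↦ a * f y) x = a * pd i f x := by
  rw [pd_mul (differentiableAt_const a) hf]; simp

lemma pd_mul_const (a : ℝ) (hf : DifferentiableAt ℝ f x) :
    pd i (fun y ↦ f y * a) x = pd i f x * a := by
  rw [pd_mul hf (differentiableAt_const a)]; simp

lemma pd_sum {ι : Type*} (s : Finset ι) {F : ι → E n → ℝ}
    (hF : ∀ k ∈ s, DifferentiableAt ℝ (F k) x) :
    pd i (fun y ↦ ∑ k ∈ s, F k y) x = ∑ k ∈ s, pd i (F k) x := by
  unfold pd
  rw [fderiv_fun_sum hF]; simp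

lemma differentiableAt_coord (j : Fin n) : DifferentiableAt ℝ (fun y : E n ↦ y j) x := by
  fun_prop

@[simp] lemma pd_coord (i j : Fin n) : pd i (fun y : E n ↦ y j) x = if i = j then 1 else 0 := by
  have : HasFDerivAt (fun y : E n ↦ y j) (EuclideanSpace.proj j : E n →L[ℝ] ℝ) x :=
    (EuclideanSpace.proj j : E n →L[ℝ] ℝ).hasFDerivAt
  unfold pd
  rw [this.fderiv]
  simp [eq_comm]

lemma contDiffOn_pd {s : Set (E n)} (hs : IsOpen s) (hf : ContDiffOn ℝ ∞ f s) (i : Fin n) :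
    ContDiffOn ℝ ∞ (pd i f) s :=
  (hf.fderiv_of_isOpen hs (m := ∞) le_rfl).clm_apply contDiffOn_const

end PartialDerivatives

section PhaseSpace

variable {n : ℕ} {T : Set (E n)}

/-- Smoothness of a function `F(q, p)` on the phase space `T × ℝⁿ` over a set `T` of positions. -/
def SmoothPhase (T : Set (E n)) (F : E n → E n → ℝ) : Prop :=
  ContDiffOn ℝ ∞ (fun z : E n × E n ↦ F z.1 z.2) (T ×ˢ Set.univ)

lemma SmoothPhase.differentiableAt (hT : IsOpen T) {F : E n → E n → ℝ} (hF : SmoothPhase T F)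
    {q : E n} (hq : q ∈ T) (p : E n) :
    DifferentiableAt ℝ (fun z : E n × E n ↦ F z.1 z.2) (q, p) :=
  (hF.contDiffAt ((hT.prod isOpen_univ).mem_nhds ⟨hq, trivial⟩)).differentiableAt (by simp)

lemma SmoothPhase.hasFDerivAt_fst (hT : IsOpen T) {F : E n → E n → ℝ} (hF : SmoothPhase T F)
    {q : E n} (hq : q ∈ T) (p : E n) :
    HasFDerivAt (fun x ↦ F x p) ((fderiv ℝ (fun z : E n × E n ↦ F z.1 z.2) (q, p)).comp
      (ContinuousLinearMap.inl ℝ (E n) (E n))) q :=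
  HasFDerivAt.comp (g := fun z : E n × E n ↦ F z.1 z.2) (f := fun x ↦ (x, p)) q
    (hF.differentiableAt hT hq p).hasFDerivAt (hasFDerivAt_prodMk_left q p)

lemma SmoothPhase.hasFDerivAt_snd (hT : IsOpen T) {F : E n → E n → ℝ} (hF : SmoothPhase T F)
    {q : E n} (hq : q ∈ T) (p : E n) :
    HasFDerivAt (fun y ↦ F q y) ((fderiv ℝ (fun z : E n × E n ↦ F z.1 z.2) (q, p)).comp
      (ContinuousLinearMap.inr ℝ (E n) (E n))) p :=
  HasFDerivAt.comp (g := fun z : E n × E n ↦ F z.1 z.2) (f := fun y ↦ (q, y)) p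
    (hF.differentiableAt hT hq p).hasFDerivAt (hasFDerivAt_prodMk_right q p)

lemma SmoothPhase.pd_fst (hT : IsOpen T) {F : E n → E n → ℝ} (hF : SmoothPhase T F)
    (i : Fin n) : SmoothPhase T (fun q p ↦ pd i (fun x ↦ F x p) q) := by
  have h := (ContDiffOn.fderiv_of_isOpen hF (hT.prod isOpen_univ) (m := ∞) le_rfl).clm_apply
    (contDiffOn_const (c := ((EuclideanSpace.single i 1, 0) : E n × E n)))
  refine h.congr fun z hz ↦ ?_
  simp [pd, (hF.hasFDerivAt_fst hT hz.1 z.2).fderiv]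

lemma SmoothPhase.pd_snd (hT : IsOpen T) {F : E n → E n → ℝ} (hF : SmoothPhase T F)
    (i : Fin n) : SmoothPhase T (fun q p ↦ pd i (fun y ↦ F q y) p) := by
  have h := (ContDiffOn.fderiv_of_isOpen hF (hT.prod isOpen_univ) (m := ∞) le_rfl).clm_apply
    (contDiffOn_const (c := ((0, EuclideanSpace.single i 1) : E n × E n)))
  refine h.congr fun z hz ↦ ?_
  simp [pd, (hF.hasFDerivAt_snd hT hz.1 z.2).fderiv]

lemma SmoothPhase.hamField (hT : IsOpen T) {L F : E n → E n → ℝ} (hL : SmoothPhase T L)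
    (hF : SmoothPhase T F) : SmoothPhase T (hamField L F) := by
  refine ContDiffOn.sum fun i _ ↦ ContDiffOn.sub ?_ ?_
  · exact ContDiffOn.mul (hL.pd_snd hT i) (hF.pd_fst hT i)
  · exact ContDiffOn.mul (hL.pd_fst hT i) (hF.pd_snd hT i)

lemma SmoothPhase.iterate_hamField (hT : IsOpen T) {L F : E n → E n → ℝ} (hL : SmoothPhase T L)
    (hF : SmoothPhase T F) (k : ℕ) : SmoothPhase T ((ExtHam.hamField L)^[k] F) := by
  induction k with
  | zero => exact hF
  | succ k ih => rw [Function.iterate_succ_apply']; exact hL.hamField hT ih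

lemma hamField_congr (hT : IsOpen T) {L F F' : E n → E n → ℝ}
    (h : ∀ q ∈ T, ∀ p, F q p = F' q p) {q : E n} (hq : q ∈ T) (p : E n) :
    hamField L F q p = hamField L F' q p := by
  unfold hamField
  refine Finset.sum_congr rfl fun i _ ↦ ?_
  rw [pd_congr_of_eqOn hT hq (fun x hx ↦ h x hx p), funext (fun y ↦ h q hq y)]

lemma hamField_add_const_mul (hT : IsOpen T) {L F F' : E n → E n → ℝ} (a b : ℝ)
    (hF : SmoothPhase T F) (hF' : SmoothPhase T F') {q : E n} (hq : q ∈ T) (p : E n) :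
    hamField L (fun q p ↦ a * F q p + b * F' q p) q p
      = a * hamField L F q p + b * hamField L F' q p := by
  have h1 := (hF.hasFDerivAt_fst hT hq p).differentiableAt
  have h2 := (hF.hasFDerivAt_snd hT hq p).differentiableAt
  have h1' := (hF'.hasFDerivAt_fst hT hq p).differentiableAt
  have h2' := (hF'.hasFDerivAt_snd hT hq p).differentiableAt
  unfold hamField
  rw [Finset.mul_sum, Finset.mul_sum, ← Finset.sum_add_distrib]
  refine Finset.sum_congr rfl fun i _ ↦ ?_
  rw [pd_add (h1.const_mul a) (h1'.const_mul b), pd_add (h2.const_mul a) (h2'.const_mul b),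
    pd_const_mul a h1, pd_const_mul b h1', pd_const_mul a h2, pd_const_mul b h2']
  ring

/-- `X_L` commutes with multiplication by affine functions of `L`, since `X_L L = 0`. -/
lemma hamField_affine_mul (hT : IsOpen T) {L F : E n → E n → ℝ} (a b : ℝ)
    (hL : SmoothPhase T L) (hF : SmoothPhase T F) {q : E n} (hq : q ∈ T) (p : E n) :
    hamField L (fun q p ↦ (a * L q p + b) * F q p) q p
      = (a * L q p + b) * hamField L F q p := by
  have h1 := (hF.hasFDerivAt_fst hT hq p).differentiableAt
  have h2 := (hF.hasFDerivAt_snd hT hq p).differentiableAt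
  have h1' := (hL.hasFDerivAt_fst hT hq p).differentiableAt
  have h2' := (hL.hasFDerivAt_snd hT hq p).differentiableAt
  unfold hamField
  rw [Finset.mul_sum]
  refine Finset.sum_congr rfl fun i _ ↦ ?_
  rw [pd_mul ((h1'.const_mul a).add_const b) h1, pd_mul ((h2'.const_mul a).add_const b) h2,
    pd_add (h1'.const_mul a) (differentiableAt_const b),
    pd_add (h2'.const_mul a) (differentiableAt_const b), pd_const_mul a h1', pd_const_mul a h2']
  simp
  ring

end PhaseSpace

/-! ### Powers of `U` -/

section Powers

/-- The value at index `k` of `(a + b S)ᵐ D`, where `S` is the shift `(S D) k = D (k + 1)` on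
sequences. With `a = p_u`, `b = γ(u)` and `D k = X_Lᵏ G` it is `Uᵐ(X_Lᵏ G)`. -/
def binShift (a b : ℝ) (D : ℕ → ℝ) : ℕ → ℕ → ℝ
  | 0, k => D k
  | m + 1, k => a * binShift a b D m k + b * binShift a b D m (k + 1)

/-- `A S² D = B D` implies `A S² (a + b S)ᵐ D = B (a + b S)ᵐ D`. -/
lemma binShift_shift_two {a b A B : ℝ} {D : ℕ → ℝ} (h : ∀ k, A * D (k + 2) = B * D k) (m k : ℕ) :
    A * binShift a b D m (k + 2) = B * binShift a b D m k := by
  induction m generalizing k with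
  | zero => exact h k
  | succ m ih =>
    simp only [binShift]
    linear_combination a * ih k + b * ih (k + 1)

open Filter Topology in
lemma tendsto_binShift_div_pow (b : ℝ) (D : ℕ → ℝ) (m k : ℕ) :
    Tendsto (fun a ↦ binShift a b D m k / a ^ m) atTop (𝓝 (D k)) := by
  induction m generalizing k with
  | zero => simp [binShift]
  | succ m ih =>
    have h := (ih k).add ((tendsto_const_nhds (x := b)).div_atTop tendsto_id |>.mul (ih (k + 1)))
    simp only [zero_mul, add_zero] at h
    refine h.congr' ?_
    filter_upwards [eventually_gt_atTop 0] with a ha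
    simp only [binShift, id]
    field_simp
    ring

open Filter Topology in
/-- If a combination of the polynomials `binShift a b D m k` in `a` vanishes identically, so do its
two leading coefficients; `binShift a b D m k` has the leading term `D k * a ^ m`. -/
lemma leading_coeffs_eq_zero {b A B C : ℝ} {D : ℕ → ℝ} {m : ℕ}
    (h : ∀ a, A * a * binShift a b D m 1 + B * binShift a b D m 2 - C * binShift a b D m 0 = 0) :
    A * D 1 = 0 ∧ (A = 0 → B * D 2 = C * D 0) := by
  have lim (k : ℕ) := tendsto_binShift_div_pow b D m k
  constructor
  · have h0 := ((lim 1).const_mul A).add ((((lim 2).const_mul B).sub ((lim 0).const_mul C)).mul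
      (tendsto_inv_atTop_zero (𝕜 := ℝ)))
    rw [mul_zero, add_zero] at h0
    refine tendsto_nhds_unique h0 (tendsto_const_nhds.congr' ?_)
    filter_upwards [eventually_gt_atTop 0] with a ha
    have := h a
    field_simp
    linear_combination -this
  · rintro rfl
    have h0 := ((lim 2).const_mul B).sub ((lim 0).const_mul C)
    refine sub_eq_zero.1 (tendsto_nhds_unique h0 (tendsto_const_nhds.congr' ?_))
    filter_upwards [eventually_gt_atTop 0] with a ha
    have := h a
    field_simp
    linear_combination -this

lemma hasDerivAt_binShift_left (a b : ℝ) (D : ℕ → ℝ) (m k : ℕ) :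
    HasDerivAt (fun t ↦ binShift t b D (m + 1) k) ((m + 1) * binShift a b D m k) a := by
  induction m generalizing k with
  | zero =>
    simpa [binShift] using ((hasDerivAt_id a).mul_const (D k)).add_const (b * D (k + 1))
  | succ m ih =>
    have := ((hasDerivAt_id a).mul (ih k)).add ((ih (k + 1)).const_mul b)
    refine this.congr_deriv ?_
    simp only [binShift, id]
    push_cast
    ring

lemma hasDerivAt_binShift_right (a : ℝ) {γ : ℝ → ℝ} {γ' u : ℝ} (hγ : HasDerivAt γ γ' u)
    (D : ℕ → ℝ) (m k : ℕ) :
    HasDerivAt (fun t ↦ binShift a (γ t) D (m + 1) k)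
      ((m + 1) * γ' * binShift a (γ u) D m (k + 1)) u := by
  induction m generalizing k with
  | zero => simpa [binShift] using (hγ.mul_const (D (k + 1))).const_add (a * D k)
  | succ m ih =>
    have := ((ih k).const_mul a).add (hγ.mul (ih (k + 1)))
    refine this.congr_deriv ?_
    simp only [binShift]
    push_cast
    ring

variable {n : ℕ} {T : Set (E n)} {L F : E n → E n → ℝ}

lemma SmoothPhase.binShift (hT : IsOpen T) (hL : SmoothPhase T L) (hF : SmoothPhase T F)
    (a b : ℝ) (m k : ℕ) :
    SmoothPhase T
      (fun q p ↦ ExtHam.binShift a b (fun k ↦ (ExtHam.hamField L)^[k] F q p) m k) := by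
  induction m generalizing k with
  | zero => exact hL.iterate_hamField hT hF k
  | succ m ih => exact (contDiffOn_const.mul (ih k)).add (contDiffOn_const.mul (ih (k + 1)))

lemma hamField_binShift (hT : IsOpen T) (hL : SmoothPhase T L) (hF : SmoothPhase T F)
    (a b : ℝ) (m k : ℕ) {q : E n} (hq : q ∈ T) (p : E n) :
    hamField L (fun q p ↦ binShift a b (fun k ↦ (hamField L)^[k] F q p) m k) q p
      = binShift a b (fun k ↦ (hamField L)^[k] F q p) m (k + 1) := by
  induction m generalizing k with
  | zero => simp only [binShift, Function.iterate_succ_apply']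
  | succ m ih =>
    simp only [binShift]
    rw [hamField_add_const_mul hT a b (hL.binShift hT hF a b m k)
      (hL.binShift hT hF a b m (k + 1)) hq, ih, ih]

lemma powU_eq_binShift (hT : IsOpen T) {G : E n → ℝ} (hL : SmoothPhase T L)
    (hG : SmoothPhase T (fun q _ ↦ G q)) (γ : ℝ → ℝ) (m : ℕ) (u a : ℝ) {q : E n} (hq : q ∈ T)
    (p : E n) :
    powU L γ m G u a q p
      = binShift a (γ u) (fun k ↦ (hamField L)^[k] (fun q _ ↦ G q) q p) m 0 := by
  induction m generalizing q p with
  | zero => rfl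
  | succ m ih =>
    have : powU L γ (m + 1) G = opU L γ (powU L γ m G) := Function.iterate_succ_apply' ..
    rw [this]
    simp only [opU, binShift]
    rw [ih hq p, hamField_congr hT (fun q hq p ↦ ih hq p) hq p,
      hamField_binShift hT hL hG _ _ _ _ hq p]

/-- `X_H(U^{m+1} G) = Uᵐ((α + (m+1)γ') p_u X_L G + αγ X_L² G - (m+1)(α'L + f') G)`: the commutator
`[X_H, U] = p_u γ' X_L - (α'L + f')` commutes with `U`. -/
lemma hamFieldExt_powU (hT : IsOpen T) {G : E n → ℝ} (hL : SmoothPhase T L)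
    (hG : SmoothPhase T (fun q _ ↦ G q)) {α f γ : ℝ → ℝ} {u : ℝ} (hα : DifferentiableAt ℝ α u)
    (hf : DifferentiableAt ℝ f u) (hγ : DifferentiableAt ℝ γ u) (m : ℕ) (a : ℝ) {q : E n}
    (hq : q ∈ T) (p : E n) {D : ℕ → ℝ} (hD : ∀ k, D k = (hamField L)^[k] (fun q _ ↦ G q) q p) :
    hamFieldExt (extHam L α f) (powU L γ (m + 1) G) u a q p
      = (α u + (m + 1) * deriv γ u) * a * binShift a (γ u) D m 1
        + α u * γ u * binShift a (γ u) D m 2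
        - (m + 1) * (deriv α u * L q p + deriv f u) * binShift a (γ u) D m 0 := by
  obtain rfl : D = fun k ↦ (hamField L)^[k] (fun q _ ↦ G q) q p := funext hD
  have e1 : deriv (fun t ↦ extHam L α f u t q p) a = a := by
    have : HasDerivAt (fun t ↦ extHam L α f u t q p) _ a :=
      ((((hasDerivAt_pow 2 a).const_mul (1 / 2)).add_const (α u * L q p)).add_const (f u))
    rw [this.deriv]; norm_num; ring
  have e2 : deriv (fun t ↦ extHam L α f t a q p) u = deriv α u * L q p + deriv f u :=
    (((hα.hasDerivAt.mul_const (L q p)).const_add ((1 / 2) * a ^ 2)).add hf.hasDerivAt).deriv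
  have e3 : deriv (fun t ↦ powU L γ (m + 1) G t a q p) u = (m + 1) * deriv γ u *
      binShift a (γ u) (fun k ↦ (hamField L)^[k] (fun q _ ↦ G q) q p) m 1 := by
    simp only [fun t ↦ powU_eq_binShift hT hL hG γ (m + 1) t a hq p]
    exact (hasDerivAt_binShift_right a hγ.hasDerivAt _ m 0).deriv
  have e4 : deriv (fun t ↦ powU L γ (m + 1) G u t q p) a = (m + 1) *
      binShift a (γ u) (fun k ↦ (hamField L)^[k] (fun q _ ↦ G q) q p) m 0 := by
    simp only [fun t ↦ powU_eq_binShift hT hL hG γ (m + 1) u t hq p]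
    exact (hasDerivAt_binShift_left a (γ u) _ m 0).deriv
  have e5 : hamField (extHam L α f u a) (powU L γ (m + 1) G u a) q p
      = α u * hamField L (powU L γ (m + 1) G u a) q p := by
    have h1 := (hL.hasFDerivAt_fst hT hq p).differentiableAt
    have h2 := (hL.hasFDerivAt_snd hT hq p).differentiableAt
    unfold hamField extHam
    rw [Finset.mul_sum]
    refine Finset.sum_congr rfl fun i _ ↦ ?_
    rw [pd_add ((h1.const_mul _).const_add _) (differentiableAt_const _),
      pd_add ((h2.const_mul _).const_add _) (differentiableAt_const _),
      pd_add (differentiableAt_const _) (h1.const_mul _),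
      pd_add (differentiableAt_const _) (h2.const_mul _), pd_const_mul _ h1, pd_const_mul _ h2]
    simp
    ring
  unfold hamFieldExt
  rw [e1, e2, e3, e4, e5, hamField_congr hT
    (fun q hq p ↦ powU_eq_binShift hT hL hG γ (m + 1) u a hq p) hq p,
    hamField_binShift hT hL hG _ _ _ _ hq p]
  simp only [binShift]
  ring

/-- If `X_L² G = κ G` with `κ` affine in `L`, then `X_L^{k+2} G = κ X_L^k G`. -/
lemma iterate_hamField_add_two (hT : IsOpen T) (hL : SmoothPhase T L) (hF : SmoothPhase T F)
    {a b : ℝ} (h : ∀ q ∈ T, ∀ p, hamField L (hamField L F) q p = (a * L q p + b) * F q p)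
    (k : ℕ) {q : E n} (hq : q ∈ T) (p : E n) :
    (hamField L)^[k + 2] F q p = (a * L q p + b) * (hamField L)^[k] F q p := by
  induction k generalizing q p with
  | zero => exact h q hq p
  | succ k ih =>
    rw [Function.iterate_succ_apply' (n := k + 2), hamField_congr hT (fun q hq p ↦ ih hq p) hq p,
      hamField_affine_mul hT a b hL (hL.iterate_hamField hT hF k) hq p,
      Function.iterate_succ_apply' (n := k)]

end Powers

/-! ### The metric and the connection in coordinates -/

section Coordinates

variable {n : ℕ} {Q : Type*} [TopologicalSpace Q] [ChartedSpace (E n) Q]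
  {e : OpenPartialHomeomorph Q (E n)}

lemma contDiffOn_rep (he : e ∈ charts n Q) {G : Q → ℝ} (hG : ContMDiff (𝓡 n) 𝓘(ℝ, ℝ) ∞ G) :
    ContDiffOn ℝ ∞ (rep e G) e.target :=
  contMDiffOn_iff_contDiffOn.1
    (hG.comp_contMDiffOn (contMDiffOn_symm_of_mem_maximalAtlas he))

lemma smoothPhase_of_contDiffOn {f : E n → ℝ} {s : Set (E n)} (hf : ContDiffOn ℝ ∞ f s) :
    SmoothPhase s (fun q _ ↦ f q) :=
  hf.comp contDiffOn_fst fun _ hz ↦ hz.1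

lemma smoothPhase_coord (s : Set (E n)) (i : Fin n) : SmoothPhase s (fun _ p ↦ p i) := by
  unfold SmoothPhase
  fun_prop

variable [IsManifold (𝓡 n) ∞ Q] (g : PseudoRiemannianMetric n Q)

/-- The coordinate vector fields are smooth, as images of constant fields under the tangent map of
the inverse chart. -/
lemma contMDiffAt_coordVec (he : e ∈ charts n Q) {q : E n} (hq : q ∈ e.target) (i : Fin n) :
    ContMDiffAt (𝓡 n) (𝓡 n).tangent ∞
      (fun q ↦ (Bundle.TotalSpace.mk' (E n) (e.symm q) (coordVec e q i) :
        TangentBundle (𝓡 n) Q)) q := by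
  have h1 : ContMDiffOn (𝓡 n) (𝓡 n) ∞ e.symm e.target := contMDiffOn_symm_of_mem_maximalAtlas he
  have h2 := h1.contMDiffOn_tangentMapWithin (m := ∞) le_rfl e.open_target.uniqueMDiffOn
  have h3 : ContMDiffAt (𝓡 n) (𝓡 n).tangent ∞
      (fun q ↦ (⟨q, EuclideanSpace.single i (1 : ℝ)⟩ : TangentBundle (𝓡 n) (E n))) q := by
    have := contMDiffAt_vectorSpace_iff_contDiffAt (𝕜 := ℝ) (E := E n) (n := ∞)
      (V := fun _ ↦ EuclideanSpace.single i (1 : ℝ)) (x := q)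
    exact this.2 contDiffAt_const
  have h4 := (h2.contMDiffAt (x := ⟨q, EuclideanSpace.single i (1 : ℝ)⟩)
    ((e.open_target.preimage (FiberBundle.continuous_proj (E n) _)).mem_nhds hq)).comp q h3
  refine h4.congr_of_eventuallyEq ?_
  filter_upwards [e.open_target.mem_nhds hq] with x hx
  simp only [Function.comp, tangentMapWithin, coordVec]
  rw [mfderivWithin_of_isOpen e.open_target hx]

lemma contDiffOn_gLow (he : e ∈ charts n Q) (i j : Fin n) :
    ContDiffOn ℝ ∞ (fun q ↦ gLow g e q i j) e.target := by
  intro q hq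
  have hb : ContMDiffAt (𝓡 n) (𝓡 n) ∞ e.symm q :=
    contMDiffAt_symm_of_mem_maximalAtlas he hq
  have h := ContMDiffAt.clm_bundle_apply₂ (F₁ := E n) (F₂ := E n) (F₃ := ℝ)
    (E₁ := TangentSpace (𝓡 n)) (E₂ := TangentSpace (𝓡 n))
    (E₃ := Bundle.Trivial Q ℝ) (b := e.symm)
    (g.contMDiff.contMDiffAt.comp q hb)
    (contMDiffAt_coordVec he hq i) (contMDiffAt_coordVec he hq j)
  simp only [Bundle.contMDiffAt_totalSpace] at h
  exact (contMDiffAt_iff_contDiffAt.1 h.2).contDiffWithinAt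

lemma gLow_symm (q : E n) (i j : Fin n) : gLow g e q i j = gLow g e q j i :=
  g.symm _ _ _

lemma isUnit_det_gLow (he : e ∈ charts n Q) {q : E n} (hq : q ∈ e.target) :
    IsUnit (gLow g e q).det := by
  have hd : e.MDifferentiable (𝓡 n) (𝓡 n) :=
    ⟨(contMDiffOn_of_mem_maximalAtlas he).mdifferentiableOn (by simp),
      (contMDiffOn_symm_of_mem_maximalAtlas he).mdifferentiableOn (by simp)⟩
  -- a null vector of the matrix is the coordinate vector of a tangent vector in the kernel of `g`
  have hbij := hd.symm.mfderiv_bijective (x := q) hq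
  rw [isUnit_iff_ne_zero]
  intro hdet
  obtain ⟨v, hv, hv0⟩ := Matrix.exists_mulVec_eq_zero_iff.2 hdet
  have hvec (w : Fin n → ℝ) : mfderiv (𝓡 n) (𝓡 n) e.symm q (WithLp.toLp 2 w : E n)
      = ∑ i, w i • coordVec e q i := by
    have : (WithLp.toLp 2 w : E n) = ∑ i, w i • (EuclideanSpace.single i (1 : ℝ) : E n) := by
      ext j; simp [Pi.single_apply]
    rw [this]
    erw [map_sum]
    refine Finset.sum_congr rfl fun i _ ↦ ?_
    erw [map_smul]
    rfl
  have key : mfderiv (𝓡 n) (𝓡 n) e.symm q (WithLp.toLp 2 v : E n) = 0 := by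
    refine g.nondegenerate _ _ fun w ↦ ?_
    obtain ⟨w', rfl⟩ := hbij.2 w
    have hw : w' = WithLp.toLp 2 (w' : E n).ofLp := rfl
    have hsum : g.val (e.symm q) (∑ j, v j • coordVec e q j) (∑ i, w'.ofLp i • coordVec e q i)
        = ∑ i, w'.ofLp i * ((gLow g e q).mulVec v i) := by
      rw [map_sum]
      refine Finset.sum_congr rfl fun i _ ↦ ?_
      rw [map_smul, smul_eq_mul, g.symm, map_sum]
      congr 1
      refine Finset.sum_congr rfl fun j _ ↦ ?_
      rw [map_smul, smul_eq_mul, mul_comm]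
      rfl
    rw [hw, hvec, hvec]
    refine hsum.trans ?_
    simp [hv0]
  have h0 : (WithLp.toLp 2 v : E n) = 0 := hbij.1 (key.trans (map_zero _).symm)
  exact hv (by simpa using h0)


lemma contDiffOn_det {s : Set (E n)} {ι : Type*} [Fintype ι] [DecidableEq ι]
    {M : E n → Matrix ι ι ℝ} (hM : ∀ i j, ContDiffOn ℝ ∞ (fun q ↦ M q i j) s) :
    ContDiffOn ℝ ∞ (fun q ↦ (M q).det) s := by
  simp only [Matrix.det_apply]
  exact ContDiffOn.sum fun σ _ ↦ (contDiffOn_prod fun i _ ↦ hM _ _).const_smul _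

lemma contDiffOn_gUp (he : e ∈ charts n Q) (i j : Fin n) :
    ContDiffOn ℝ ∞ (fun q ↦ gUp g e q i j) e.target := by
  have hdet : ContDiffOn ℝ ∞ (fun q ↦ (gLow g e q).det) e.target :=
    contDiffOn_det fun i j ↦ contDiffOn_gLow g he i j
  have hadj : ContDiffOn ℝ ∞ (fun q ↦ (gLow g e q).adjugate i j) e.target := by
    simp only [Matrix.adjugate_apply]
    refine contDiffOn_det fun k l ↦ ?_
    by_cases hk : k = j
    · subst hk
      simp only [Matrix.updateRow_self]
      exact contDiffOn_const
    · simp only [Matrix.updateRow_ne hk]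
      exact contDiffOn_gLow g he k l
  refine ((hdet.inv fun q hq ↦ (isUnit_det_gLow g he hq).ne_zero).mul hadj).congr fun q hq ↦ ?_
  simp [gUp, Matrix.inv_def]

lemma gUp_symm (q : E n) (i j : Fin n) : gUp g e q i j = gUp g e q j i := by
  have h : (gLow g e q).transpose = gLow g e q := Matrix.ext fun i j ↦ gLow_symm g q j i
  have : (gUp g e q).transpose = gUp g e q := by
    rw [gUp, Matrix.transpose_nonsing_inv, h]
  exact congrFun (congrFun this j) i

lemma sum_gUp_mul_gLow (he : e ∈ charts n Q) {q : E n} (hq : q ∈ e.target) (i j : Fin n) :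
    ∑ k, gUp g e q i k * gLow g e q k j = if i = j then 1 else 0 := by
  have := congrFun (congrFun (Matrix.nonsing_inv_mul _ (isUnit_det_gLow g he hq)) i) j
  rwa [Matrix.mul_apply, Matrix.one_apply] at this

lemma sum_gLow_mul_gUp (he : e ∈ charts n Q) {q : E n} (hq : q ∈ e.target) (i j : Fin n) :
    ∑ k, gLow g e q i k * gUp g e q k j = if i = j then 1 else 0 := by
  have := congrFun (congrFun (Matrix.mul_nonsing_inv _ (isUnit_det_gLow g he hq)) i) j
  rwa [Matrix.mul_apply, Matrix.one_apply] at this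

/-- Raising an index is injective. -/
lemma eq_zero_of_sum_gUp_mul (he : e ∈ charts n Q) {q : E n} (hq : q ∈ e.target) {w : Fin n → ℝ}
    (h : ∀ i, ∑ j, gUp g e q i j * w j = 0) : w = 0 := by
  have h1 : (gUp g e q).mulVec w = 0 := funext h
  have h2 : (gLow g e q).mulVec ((gUp g e q).mulVec w) = w := by
    rw [Matrix.mulVec_mulVec, gUp, Matrix.mul_nonsing_inv _ (isUnit_det_gLow g he hq),
      Matrix.one_mulVec]
  rw [← h2, h1, Matrix.mulVec_zero]

/-- Lowering an index is injective. -/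
lemma eq_zero_of_sum_gLow_mul (he : e ∈ charts n Q) {q : E n} (hq : q ∈ e.target) {w : Fin n → ℝ}
    (h : ∀ i, ∑ j, gLow g e q i j * w j = 0) : w = 0 := by
  have h1 : (gLow g e q).mulVec w = 0 := funext h
  have h2 : (gUp g e q).mulVec ((gLow g e q).mulVec w) = w := by
    rw [Matrix.mulVec_mulVec, gUp, Matrix.nonsing_inv_mul _ (isUnit_det_gLow g he hq),
      Matrix.one_mulVec]
  rw [← h2, h1, Matrix.mulVec_zero]

lemma differentiableAt_of_contDiffOn {f : E n → ℝ} {s : Set (E n)} (hs : IsOpen s)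
    (hf : ContDiffOn ℝ ∞ f s) {q : E n} (hq : q ∈ s) : DifferentiableAt ℝ f q :=
  (hf.contDiffAt (hs.mem_nhds hq)).differentiableAt (by simp)

/-- `∂ₐ g^{ij} = - g^{ic} (∂ₐ g_{cd}) g^{dj}`. -/
lemma pd_gUp (he : e ∈ charts n Q) {q : E n} (hq : q ∈ e.target) (a i j : Fin n) :
    pd a (fun x ↦ gUp g e x i j) q
      = -∑ d, (∑ c, gUp g e q i c * pd a (fun x ↦ gLow g e x c d) q) * gUp g e q d j := by
  have hU (i j) := differentiableAt_of_contDiffOn e.open_target (contDiffOn_gUp g he i j) hq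
  have hL (i j) := differentiableAt_of_contDiffOn e.open_target (contDiffOn_gLow g he i j) hq
  -- the derivative of `g^{ic} g_{cd} = δ_{id}`
  have key (d : Fin n) : ∑ c, pd a (fun x ↦ gUp g e x i c) q * gLow g e q c d
      = -∑ c, gUp g e q i c * pd a (fun x ↦ gLow g e x c d) q := by
    have h1 : pd a (fun x ↦ ∑ c, gUp g e x i c * gLow g e x c d) q = 0 := by
      rw [pd_congr_of_eqOn e.open_target hq fun x hx ↦ sum_gUp_mul_gLow g he hx i d, pd_const]
    rw [pd_sum _ fun c _ ↦ (hU i c).fun_mul (hL c d)] at h1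
    rw [eq_neg_iff_add_eq_zero, ← Finset.sum_add_distrib, ← h1]
    exact Finset.sum_congr rfl fun c _ ↦ (pd_mul (hU i c) (hL c d)).symm
  calc pd a (fun x ↦ gUp g e x i j) q
      = ∑ c, pd a (fun x ↦ gUp g e x i c) q * ∑ d, gLow g e q c d * gUp g e q d j := by
        simp [sum_gLow_mul_gUp g he hq]
    _ = ∑ d, (∑ c, pd a (fun x ↦ gUp g e x i c) q * gLow g e q c d) * gUp g e q d j := by
        simp only [Finset.mul_sum, Finset.sum_mul, ← mul_assoc]
        exact Finset.sum_comm
    _ = _ := by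
        simp only [key, neg_mul, Finset.sum_neg_distrib]

lemma contDiffOn_christoffel (he : e ∈ charts n Q) (k i j : Fin n) :
    ContDiffOn ℝ ∞ (christoffel g e k i j) e.target := by
  refine contDiffOn_const.mul (ContDiffOn.sum fun l _ ↦ (contDiffOn_gUp g he k l).mul ?_)
  exact ((contDiffOn_pd e.open_target (contDiffOn_gLow g he j l) i).add
    (contDiffOn_pd e.open_target (contDiffOn_gLow g he i l) j)).sub
    (contDiffOn_pd e.open_target (contDiffOn_gLow g he i j) l)

lemma christoffel_symm (k i j : Fin n) (q : E n) :
    christoffel g e k i j q = christoffel g e k j i q := by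
  unfold christoffel
  congr 1
  refine Finset.sum_congr rfl fun l _ ↦ ?_
  rw [funext fun x ↦ gLow_symm g x i j]
  ring

/-- The Christoffel symbols of the first kind. -/
lemma sum_christoffel_mul_gLow (he : e ∈ charts n Q) {q : E n} (hq : q ∈ e.target)
    (i j a : Fin n) :
    ∑ k, christoffel g e k i j q * gLow g e q a k
      = (1 / 2) * (pd i (fun x ↦ gLow g e x j a) q + pd j (fun x ↦ gLow g e x i a) q
        - pd a (fun x ↦ gLow g e x i j) q) := by
  set S : Fin n → ℝ := fun l ↦ pd i (fun x ↦ gLow g e x j l) q + pd j (fun x ↦ gLow g e x i l) q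
        - pd l (fun x ↦ gLow g e x i j) q
  calc ∑ k, christoffel g e k i j q * gLow g e q a k
      = (1 / 2) * ∑ l, (∑ k, gLow g e q a k * gUp g e q k l) * S l := by
        simp only [christoffel, Finset.mul_sum, Finset.sum_mul]
        rw [Finset.sum_comm]
        refine Finset.sum_congr rfl fun l _ ↦ Finset.sum_congr rfl fun k _ ↦ ?_
        simp only [S]; ring
    _ = (1 / 2) * S a := by simp [sum_gLow_mul_gUp g he hq]

lemma smoothPhase_natHam (he : e ∈ charts n Q) {V : Q → ℝ} (hV : ContMDiff (𝓡 n) 𝓘(ℝ, ℝ) ∞ V) :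
    SmoothPhase e.target (natHam g e V) := by
  refine ContDiffOn.add (contDiffOn_const.mul (ContDiffOn.sum fun i _ ↦ ContDiffOn.sum fun j _ ↦
    ContDiffOn.mul (ContDiffOn.mul ?_ (smoothPhase_coord _ i)) (smoothPhase_coord _ j)))
    (smoothPhase_of_contDiffOn (contDiffOn_rep he hV))
  exact smoothPhase_of_contDiffOn (contDiffOn_gUp g he i j)

end Coordinates

/-! ### Integrability conditions and curvature -/

section Integrability

variable {n : ℕ} {Q : Type*} [TopologicalSpace Q] [ChartedSpace (E n) Q]
  [IsManifold (𝓡 n) ∞ Q] (g : PseudoRiemannianMetric n Q)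
  {e : OpenPartialHomeomorph Q (E n)}

lemma pfaffTotalDeriv_eq (he : e ∈ charts n Q) (K : ℝ) (i j l : Fin n) {q : E n}
    (hq : q ∈ e.target) (z : E n) :
    pfaffTotalDeriv g e K i j l q z
      = ∑ k, pd i (christoffel g e k j l) q * z k - K * pd i (fun x ↦ gLow g e x j l) q
        - z l * pfaffRHS g e K i j q z - z j * pfaffRHS g e K i l q z
        + ∑ k, christoffel g e k j l q * pfaffRHS g e K i k q z := by
  have hΓ (k) := differentiableAt_of_contDiffOn e.open_target (contDiffOn_christoffel g he k j l) hq
  have hg := differentiableAt_of_contDiffOn e.open_target (contDiffOn_gLow g he j l) hq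
  have hz (k : Fin n) : DifferentiableAt ℝ (fun w : E n ↦ w k) z := differentiableAt_coord k
  have h1 : pd i (fun x ↦ pfaffRHS g e K j l x z) q
      = ∑ k, pd i (christoffel g e k j l) q * z k - K * pd i (fun x ↦ gLow g e x j l) q := by
    have hs : DifferentiableAt ℝ (fun x ↦ ∑ k, christoffel g e k j l x * z k) q :=
      DifferentiableAt.fun_sum fun k _ ↦ (hΓ k).mul_const _
    unfold pfaffRHS
    rw [pd_sub (hs.const_add _) (hg.const_mul K), pd_add (differentiableAt_const _) hs,
      pd_const_mul K hg, pd_const, pd_sum _ fun k _ ↦ (hΓ k).mul_const _, zero_add]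
    congr 1
    exact Finset.sum_congr rfl fun k _ ↦ pd_mul_const _ (hΓ k)
  have h2 (k : Fin n) : pd k (fun w ↦ pfaffRHS g e K j l q w) z
      = christoffel g e k j l q - (if k = j then z l else 0) - (if k = l then z j else 0) := by
    have hs : DifferentiableAt ℝ (fun w : E n ↦ ∑ k, christoffel g e k j l q * w k) z :=
      DifferentiableAt.fun_sum fun k _ ↦ (hz k).const_mul _
    have hm : DifferentiableAt ℝ (fun w : E n ↦ -1 * (w j * w l)) z :=
      ((hz j).fun_mul (hz l)).const_mul _
    have : (fun w ↦ pfaffRHS g e K j l q w)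
        = fun w : E n ↦ -1 * (w j * w l) + (∑ k, christoffel g e k j l q * w k)
          - K * gLow g e q j l := by
      funext w; simp only [pfaffRHS]; ring
    rw [this, pd_sub (hm.fun_add hs) (differentiableAt_const _), pd_add hm hs, pd_const,
      pd_const_mul _ ((hz j).fun_mul (hz l)), pd_mul (hz j) (hz l),
      pd_sum _ fun k _ ↦ (hz k).const_mul _]
    simp only [pd_const_mul _ (hz _), pd_coord]
    simp
    ring
  unfold pfaffTotalDeriv
  rw [h1]
  simp only [h2, sub_mul, Finset.sum_sub_distrib, ite_mul, zero_mul, Finset.sum_ite_eq',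
    Finset.mem_univ, if_true]
  ring

/-- The integrability condition is linear in `z`, with the coefficients
`R^k_{lij} - K (g_{jl} δ^k_i - g_{il} δ^k_j)`. -/
lemma pfaffTotalDeriv_sub (he : e ∈ charts n Q) (K : ℝ) (i j l : Fin n) {q : E n}
    (hq : q ∈ e.target) (z : E n) :
    pfaffTotalDeriv g e K i j l q z - pfaffTotalDeriv g e K j i l q z
      = ∑ k, z k * (riemann g e k l i j q - K * (gLow g e q j l * (if k = i then 1 else 0)
          - gLow g e q i l * (if k = j then 1 else 0))) := by
  have hP : pfaffRHS g e K i j q z = pfaffRHS g e K j i q z := by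
    unfold pfaffRHS
    rw [gLow_symm, mul_comm (z i)]
    simp only [christoffel_symm g _ i j]
  -- the terms free of `z` cancel because the connection is metric and torsion free
  have hΓ := sum_christoffel_mul_gLow g he hq j l i
  have hΓ' := sum_christoffel_mul_gLow g he hq i l j
  rw [funext fun x ↦ gLow_symm g x l i, funext fun x ↦ gLow_symm g x j i] at hΓ
  rw [funext fun x ↦ gLow_symm g x l j] at hΓ'
  have hE (i j : Fin n) : ∑ k, christoffel g e k j l q * pfaffRHS g e K i k q z
      = -(z i * ∑ k, christoffel g e k j l q * z k)
        + ∑ k, z k * ∑ h, christoffel g e h j l q * christoffel g e k i h q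
        - K * ∑ k, christoffel g e k j l q * gLow g e q i k := by
    have : ∑ k, z k * ∑ h, christoffel g e h j l q * christoffel g e k i h q
        = ∑ h, christoffel g e h j l q * ∑ k, christoffel g e k i h q * z k := by
      simp only [Finset.mul_sum]
      rw [Finset.sum_comm]
      exact Finset.sum_congr rfl fun _ _ ↦ Finset.sum_congr rfl fun _ _ ↦ by ring
    rw [this]
    simp only [pfaffRHS, Finset.mul_sum, ← Finset.sum_neg_distrib, ← Finset.sum_add_distrib,
      ← Finset.sum_sub_distrib]
    refine Finset.sum_congr rfl fun k _ ↦ ?_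
    rw [mul_sub, mul_add, Finset.mul_sum]
    ring
  have hR : ∑ k, z k * (riemann g e k l i j q - K * (gLow g e q j l * (if k = i then 1 else 0)
          - gLow g e q i l * (if k = j then 1 else 0)))
      = (∑ k, pd i (christoffel g e k j l) q * z k - ∑ k, pd j (christoffel g e k i l) q * z k)
        + ((∑ k, z k * ∑ h, christoffel g e h j l q * christoffel g e k i h q)
          - ∑ k, z k * ∑ h, christoffel g e h i l q * christoffel g e k j h q)
        - K * (gLow g e q j l * z i - gLow g e q i l * z j) := by
    have hi (i : Fin n) : z i = ∑ k, z k * (if k = i then 1 else 0) := by simp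
    rw [hi i, hi j]
    simp only [riemann, Finset.mul_sum, ← Finset.sum_add_distrib,
      ← Finset.sum_sub_distrib]
    refine Finset.sum_congr rfl fun k _ ↦ ?_
    simp only [Finset.sum_sub_distrib, ← Finset.mul_sum]
    ring
  rw [pfaffTotalDeriv_eq g he K i j l hq, pfaffTotalDeriv_eq g he K j i l hq, hE, hE, hΓ, hΓ', hP,
    hR]
  simp only [pfaffRHS]
  ring

/-- The integrability conditions of `∇ᵢ∇ⱼ G + K gᵢⱼ G = 0` say that the curvature is constant and
equal to `K`. -/
lemma hessianEqIntegrable_iff (K : ℝ) :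
    HessianEqIntegrable g K ↔ HasConstantCurvature g K := by
  have hlow (e : OpenPartialHomeomorph Q (E n)) (q : E n) (h l i j : Fin n) :
      riemannLow g e h l i j q
          - K * (gLow g e q j l * gLow g e q h i - gLow g e q i l * gLow g e q h j)
        = ∑ k, gLow g e q h k * (riemann g e k l i j q - K * (gLow g e q j l *
          (if k = i then 1 else 0) - gLow g e q i l * (if k = j then 1 else 0))) := by
    have hi (i : Fin n) : gLow g e q h i = ∑ k, gLow g e q h k * (if k = i then 1 else 0) := by
      simp
    rw [hi i, hi j, riemannLow]
    simp only [Finset.mul_sum, ← Finset.sum_sub_distrib]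
    exact Finset.sum_congr rfl fun _ _ ↦ by ring
  constructor
  · intro H e he q hq h l i j
    rw [← sub_eq_zero, hlow]
    refine Finset.sum_eq_zero fun k _ ↦ ?_
    have := H e he q hq (EuclideanSpace.single k 1) i j l
    rw [pfaffTotalDeriv_sub g he K i j l hq] at this
    rw [mul_eq_zero]
    right
    simpa [Pi.single_apply] using this
  · intro H e he q hq z i j l
    rw [pfaffTotalDeriv_sub g he K i j l hq]
    have := eq_zero_of_sum_gLow_mul g he hq fun h ↦
      (hlow e q h l i j).symm.trans (sub_eq_zero.2 (H e he q hq h l i j))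
    refine Finset.sum_eq_zero fun k _ ↦ ?_
    rw [show _ - _ = (0 : ℝ) from congrFun this k, mul_zero]

end Integrability

/-! ### The functions `X_L G` and `X_L² G` -/

section Geodesic

variable {n : ℕ} {Q : Type*} [TopologicalSpace Q] [ChartedSpace (E n) Q]
  [IsManifold (𝓡 n) ∞ Q] (g : PseudoRiemannianMetric n Q)
  {e : OpenPartialHomeomorph Q (E n)}

/-- The velocity `g^{ij} pⱼ` of the momentum `p`. -/
noncomputable def velocity (g : PseudoRiemannianMetric n Q) (e : OpenPartialHomeomorph Q (E n))
    (q p : E n) (i : Fin n) : ℝ :=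
  ∑ j, gUp g e q i j * p j

/-- The derivative of the inverse metric, contracted with the momentum. -/
lemma pd_velocity_fst (he : e ∈ charts n Q) {q : E n} (hq : q ∈ e.target) (p : E n)
    (a i : Fin n) :
    pd a (fun x ↦ velocity g e x p i) q
      = -∑ c, ∑ d, gUp g e q i c * pd a (fun x ↦ gLow g e x c d) q * velocity g e q p d := by
  have hU (i j) := differentiableAt_of_contDiffOn e.open_target (contDiffOn_gUp g he i j) hq
  unfold velocity
  rw [pd_sum _ fun j _ ↦ (hU i j).mul_const _]
  simp only [pd_mul_const _ (hU _ _), pd_gUp g he hq, neg_mul, Finset.sum_neg_distrib,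
    Finset.sum_mul, Finset.mul_sum]
  congr 1
  rw [Finset.sum_comm]
  calc _ = ∑ d, ∑ c, ∑ j, gUp g e q i c * pd a (fun x ↦ gLow g e x c d) q * gUp g e q d j * p j :=
        Finset.sum_congr rfl fun _ _ ↦ Finset.sum_comm
    _ = _ := by
        rw [Finset.sum_comm]
        exact Finset.sum_congr rfl fun _ _ ↦ Finset.sum_congr rfl fun _ _ ↦
          Finset.sum_congr rfl fun _ _ ↦ by ring

lemma pd_velocity_snd (q p : E n) (a i : Fin n) :
    pd a (fun y ↦ velocity g e q y i) p = gUp g e q i a := by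
  unfold velocity
  rw [pd_sum _ fun j _ ↦ (differentiableAt_coord j).const_mul _]
  simp [pd_const_mul _ (differentiableAt_coord _)]

lemma smoothPhase_velocity (he : e ∈ charts n Q) (i : Fin n) :
    SmoothPhase e.target (fun q p ↦ velocity g e q p i) :=
  ContDiffOn.sum fun j _ ↦ (smoothPhase_of_contDiffOn (contDiffOn_gUp g he i j)).mul
    (smoothPhase_coord _ j)

lemma natHam_eq_velocity (V : Q → ℝ) (q p : E n) :
    natHam g e V q p = (1 / 2) * ∑ i, velocity g e q p i * p i + rep e V q := by
  simp only [natHam, velocity, Finset.sum_mul]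
  congr 2
  exact Finset.sum_congr rfl fun _ _ ↦ Finset.sum_congr rfl fun _ _ ↦ by ring

lemma pd_natHam_snd (he : e ∈ charts n Q) (V : Q → ℝ) {q : E n} (hq : q ∈ e.target) (p : E n)
    (a : Fin n) : pd a (fun y ↦ natHam g e V q y) p = velocity g e q p a := by
  have hv (i) := ((smoothPhase_velocity g he i).hasFDerivAt_snd e.open_target hq p).differentiableAt
  have hp (i : Fin n) : DifferentiableAt ℝ (fun y : E n ↦ y i) p := differentiableAt_coord i
  have hs := DifferentiableAt.fun_sum (u := Finset.univ) fun i _ ↦ (hv i).fun_mul (hp i)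
  rw [funext (natHam_eq_velocity g V q), pd_add (hs.const_mul _) (differentiableAt_const _),
    pd_const_mul _ hs, pd_sum _ fun i _ ↦ (hv i).fun_mul (hp i)]
  simp only [pd_mul (hv _) (hp _), pd_velocity_snd, pd_coord, pd_const, Finset.sum_add_distrib]
  simp [gUp_symm g q _ a, velocity]
  ring

/-- `∂ₐL = -½ (∂ₐ g_{cd}) vᶜ vᵈ + ∂ₐV`, in terms of the velocity and the lower metric. -/
lemma pd_natHam_fst (he : e ∈ charts n Q) {V : Q → ℝ} (hV : ContMDiff (𝓡 n) 𝓘(ℝ, ℝ) ∞ V)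
    {q : E n} (hq : q ∈ e.target) (p : E n) (a : Fin n) :
    pd a (fun x ↦ natHam g e V x p) q
      = -(1 / 2) * ∑ c, ∑ d, pd a (fun x ↦ gLow g e x c d) q * velocity g e q p c
          * velocity g e q p d + pd a (rep e V) q := by
  have hv (i) := ((smoothPhase_velocity g he i).hasFDerivAt_fst e.open_target hq p).differentiableAt
  have hV' := differentiableAt_of_contDiffOn e.open_target (contDiffOn_rep he hV) hq
  have hs := DifferentiableAt.fun_sum (u := Finset.univ) fun i _ ↦ (hv i).mul_const (p i)
  rw [funext fun x ↦ natHam_eq_velocity g V x p, pd_add (hs.const_mul _) hV',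
    pd_const_mul _ hs, pd_sum _ fun i _ ↦ (hv i).mul_const (p i)]
  simp only [pd_mul_const _ (hv _), pd_velocity_fst g he hq]
  have : ∑ i, (-∑ c, ∑ d, gUp g e q i c * pd a (fun x ↦ gLow g e x c d) q * velocity g e q p d)
        * p i
      = -∑ c, ∑ d, pd a (fun x ↦ gLow g e x c d) q * velocity g e q p c
          * velocity g e q p d := by
    have hc (c : Fin n) : velocity g e q p c = ∑ i, gUp g e q i c * p i :=
      Finset.sum_congr rfl fun i _ ↦ by rw [gUp_symm]
    simp only [neg_mul, Finset.sum_neg_distrib]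
    congr 1
    simp only [Finset.sum_mul]
    rw [Finset.sum_comm]
    refine Finset.sum_congr rfl fun c _ ↦ ?_
    rw [Finset.sum_comm]
    refine Finset.sum_congr rfl fun d _ ↦ ?_
    rw [hc c, Finset.mul_sum, Finset.sum_mul]
    exact Finset.sum_congr rfl fun _ _ ↦ by ring
  rw [this]
  ring

/-- `X_L G = g^{ij} pⱼ ∂ᵢG`. -/
lemma hamField_natHam_rep (he : e ∈ charts n Q) (V G : Q → ℝ) {q : E n} (hq : q ∈ e.target)
    (p : E n) :
    hamField (natHam g e V) (fun q _ ↦ rep e G q) q p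
      = ∑ i, velocity g e q p i * pd i (rep e G) q := by
  unfold hamField
  refine Finset.sum_congr rfl fun i _ ↦ ?_
  rw [pd_natHam_snd g he V hq, pd_const]
  ring

/-- The contraction of the Christoffel symbols with `vⁱ vʲ wₖ`, as an identity on arrays: `u` stands
for `g^{ij}`, `dg a c d` for `∂ₐ g_{cd}` and `w` for `∂G`. -/
lemma sum_christoffel_contraction (u : Fin n → Fin n → ℝ) (dg : Fin n → Fin n → Fin n → ℝ)
    (v w : Fin n → ℝ) :
    ∑ i, ∑ j, v i * v j * ∑ k, (1 / 2 * ∑ l, u k l * (dg i j l + dg j i l - dg l i j)) * w k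
      = ∑ l, (∑ k, u k l * w k) * (∑ i, ∑ j, v i * v j * dg i j l
          - (1 / 2) * ∑ i, ∑ j, v i * v j * dg l i j) := by
  have h1 (i j : Fin n) :
      ∑ k, (1 / 2 * ∑ l, u k l * (dg i j l + dg j i l - dg l i j)) * w k
        = ∑ l, (∑ k, u k l * w k) * (1 / 2 * (dg i j l + dg j i l - dg l i j)) := by
    simp only [Finset.mul_sum, Finset.sum_mul]
    rw [Finset.sum_comm]
    exact Finset.sum_congr rfl fun _ _ ↦ Finset.sum_congr rfl fun _ _ ↦ by ring
  have h2 (l : Fin n) : ∑ i, ∑ j, v i * v j * dg i j l = ∑ i, ∑ j, v i * v j * dg j i l := by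
    rw [Finset.sum_comm]
    exact Finset.sum_congr rfl fun _ _ ↦ Finset.sum_congr rfl fun _ _ ↦ by ring
  have h3 (l : Fin n) : ∑ i, ∑ j, v i * v j * dg i j l
          - (1 / 2) * ∑ i, ∑ j, v i * v j * dg l i j
      = ∑ i, ∑ j, v i * v j * (1 / 2 * (dg i j l + dg j i l - dg l i j)) := by
    have : ∑ i, ∑ j, v i * v j * dg i j l = (1 / 2) * ∑ i, ∑ j, v i * v j * dg i j l
        + (1 / 2) * ∑ i, ∑ j, v i * v j * dg j i l := by rw [← h2]; ring
    rw [this]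
    simp only [Finset.mul_sum, ← Finset.sum_add_distrib, ← Finset.sum_sub_distrib]
    exact Finset.sum_congr rfl fun _ _ ↦ Finset.sum_congr rfl fun _ _ ↦ by ring
  simp only [h1]
  simp only [h3]
  simp only [Finset.mul_sum (Finset.univ : Finset (Fin n))]
  calc _ = ∑ i, ∑ l, ∑ j, v i * v j *
        ((∑ k, u k l * w k) * (1 / 2 * (dg i j l + dg j i l - dg l i j))) :=
        Finset.sum_congr rfl fun _ _ ↦ Finset.sum_comm
    _ = _ := by
        rw [Finset.sum_comm]
        exact Finset.sum_congr rfl fun _ _ ↦ Finset.sum_congr rfl fun _ _ ↦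
          Finset.sum_congr rfl fun _ _ ↦ by ring

/-- `X_L² G = vⁱ vʲ ∇ᵢ∇ⱼG - ∇V · ∇G` with the velocity `vⁱ = g^{ij} pⱼ`. -/
lemma hamField_hamField_natHam_rep (he : e ∈ charts n Q) {V G : Q → ℝ}
    (hV : ContMDiff (𝓡 n) 𝓘(ℝ, ℝ) ∞ V) (hG : ContMDiff (𝓡 n) 𝓘(ℝ, ℝ) ∞ G) {q : E n}
    (hq : q ∈ e.target) (p : E n) :
    hamField (natHam g e V) (hamField (natHam g e V) (fun q _ ↦ rep e G q)) q p
      = ∑ i, ∑ j, velocity g e q p i * velocity g e q p j * hessian g e G i j q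
        - gradDot g e V G q := by
  have hG1 (i) := differentiableAt_of_contDiffOn e.open_target
    (contDiffOn_pd e.open_target (contDiffOn_rep he hG) i) hq
  have hv1 (i) :=
    ((smoothPhase_velocity g he i).hasFDerivAt_fst e.open_target hq p).differentiableAt
  have hv2 (i) :=
    ((smoothPhase_velocity g he i).hasFDerivAt_snd e.open_target hq p).differentiableAt
  rw [hamField_congr e.open_target (fun q hq p ↦ hamField_natHam_rep g he V G hq p) hq]
  have e1 (a : Fin n) : pd a (fun x ↦ ∑ i, velocity g e x p i * pd i (rep e G) x) q
      = ∑ i, velocity g e q p i * pd a (pd i (rep e G)) q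
        - ∑ i, (∑ c, ∑ d, gUp g e q i c * pd a (fun x ↦ gLow g e x c d) q * velocity g e q p d)
          * pd i (rep e G) q := by
    rw [pd_sum _ fun i _ ↦ (hv1 i).fun_mul (hG1 i), ← Finset.sum_sub_distrib]
    refine Finset.sum_congr rfl fun i _ ↦ ?_
    rw [pd_mul (hv1 i) (hG1 i), pd_velocity_fst g he hq]
    ring
  have e2 (a : Fin n) : pd a (fun y ↦ ∑ i, velocity g e q y i * pd i (rep e G) q) p
      = ∑ i, gUp g e q i a * pd i (rep e G) q := by
    rw [pd_sum _ fun i _ ↦ (hv2 i).mul_const _]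
    exact Finset.sum_congr rfl fun i _ ↦ by rw [pd_mul_const _ (hv2 i), pd_velocity_snd]
  unfold hamField
  simp only [e1, e2, pd_natHam_snd g he V hq, pd_natHam_fst g he hV hq]
  have hgrad : gradDot g e V G q
      = ∑ a, pd a (rep e V) q * ∑ i, gUp g e q i a * pd i (rep e G) q := by
    simp only [gradDot, Finset.mul_sum]
    exact Finset.sum_congr rfl fun a _ ↦ Finset.sum_congr rfl fun i _ ↦ by
      rw [gUp_symm g q i a]; ring
  have hΓ := sum_christoffel_contraction (gUp g e q)
    (fun a c d ↦ pd a (fun x ↦ gLow g e x c d) q) (velocity g e q p) (fun k ↦ pd k (rep e G) q)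
  have hhess : ∑ i, ∑ j, velocity g e q p i * velocity g e q p j * hessian g e G i j q
      = ∑ i, ∑ j, velocity g e q p i * velocity g e q p j * pd i (pd j (rep e G)) q
        - ∑ l, (∑ k, gUp g e q k l * pd k (rep e G) q) *
          (∑ i, ∑ j, velocity g e q p i * velocity g e q p j * pd i (fun x ↦ gLow g e x j l) q
          - (1 / 2) * ∑ i, ∑ j, velocity g e q p i * velocity g e q p j *
            pd l (fun x ↦ gLow g e x i j) q) := by
    rw [← hΓ]
    simp only [← Finset.sum_sub_distrib]
    refine Finset.sum_congr rfl fun i _ ↦ Finset.sum_congr rfl fun j _ ↦ ?_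
    rw [hessian, mul_sub]
    rfl
  rw [hhess, hgrad]
  set v := velocity g e q p
  -- the derivative of `g^{ij}` produces the part of the Christoffel symbols that is not `∂ₗ g_{ij}`
  have hswap : ∑ a, v a * ∑ i, (∑ c, ∑ d, gUp g e q i c * pd a (fun x ↦ gLow g e x c d) q * v d)
          * pd i (rep e G) q
      = ∑ l, (∑ k, gUp g e q k l * pd k (rep e G) q) *
          ∑ i, ∑ j, v i * v j * pd i (fun x ↦ gLow g e x j l) q := by
    have h1 (a : Fin n) :
        ∑ i, (∑ c, ∑ d, gUp g e q i c * pd a (fun x ↦ gLow g e x c d) q * v d)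
            * pd i (rep e G) q
          = ∑ c, (∑ k, gUp g e q k c * pd k (rep e G) q) *
            ∑ d, v d * pd a (fun x ↦ gLow g e x d c) q := by
      simp only [Finset.sum_mul]
      rw [Finset.sum_comm]
      refine Finset.sum_congr rfl fun c _ ↦ Finset.sum_congr rfl fun i _ ↦ ?_
      rw [Finset.mul_sum]
      refine Finset.sum_congr rfl fun d _ ↦ ?_
      rw [funext fun x ↦ gLow_symm g x c d]
      ring
    simp only [h1]
    simp only [Finset.mul_sum (Finset.univ : Finset (Fin n))]
    rw [Finset.sum_comm]
    exact Finset.sum_congr rfl fun _ _ ↦ Finset.sum_congr rfl fun _ _ ↦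
      Finset.sum_congr rfl fun _ _ ↦ by ring
  have hG2 : ∑ a, v a * ∑ i, v i * pd a (pd i (rep e G)) q
      = ∑ i, ∑ j, v i * v j * pd i (pd j (rep e G)) q := by
    simp only [Finset.mul_sum, mul_assoc]
  -- the derivative of the kinetic energy produces the part `∂ₗ g_{ij}`
  have hV2 : ∑ a, (-(1 / 2) * ∑ c, ∑ d, pd a (fun x ↦ gLow g e x c d) q * v c * v d
        + pd a (rep e V) q) * ∑ i, gUp g e q i a * pd i (rep e G) q
      = ∑ a, pd a (rep e V) q * ∑ i, gUp g e q i a * pd i (rep e G) q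
        - ∑ l, (∑ k, gUp g e q k l * pd k (rep e G) q) *
          ((1 / 2) * ∑ i, ∑ j, v i * v j * pd l (fun x ↦ gLow g e x i j) q) := by
    rw [← Finset.sum_sub_distrib]
    refine Finset.sum_congr rfl fun a _ ↦ ?_
    have : ∑ c, ∑ d, pd a (fun x ↦ gLow g e x c d) q * v c * v d
        = ∑ i, ∑ j, v i * v j * pd a (fun x ↦ gLow g e x i j) q :=
      Finset.sum_congr rfl fun _ _ ↦ Finset.sum_congr rfl fun _ _ ↦ by ring
    rw [this]
    ring
  simp only [mul_sub, Finset.sum_sub_distrib]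
  rw [hswap, hG2, hV2]
  ring

/-- On solutions of `∇ᵢ∇ⱼ G + K gᵢⱼ G = 0`, `X_L² G = -2K(L - V)G - ∇V · ∇G`. -/
lemma hamField_hamField_of_solvesHessianEq (he : e ∈ charts n Q) {V G : Q → ℝ}
    (hV : ContMDiff (𝓡 n) 𝓘(ℝ, ℝ) ∞ V) (hG : ContMDiff (𝓡 n) 𝓘(ℝ, ℝ) ∞ G) {K : ℝ}
    (hK : SolvesHessianEq g K G) {q : E n} (hq : q ∈ e.target) (p : E n) :
    hamField (natHam g e V) (hamField (natHam g e V) (fun q _ ↦ rep e G q)) q p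
      = -2 * K * (natHam g e V q p - rep e V q) * rep e G q - gradDot g e V G q := by
  have hlow (j : Fin n) : ∑ i, velocity g e q p i * gLow g e q i j = p j := by
    calc _ = ∑ k, p k * ∑ i, gUp g e q k i * gLow g e q i j := by
          simp only [velocity, Finset.sum_mul, Finset.mul_sum]
          rw [Finset.sum_comm]
          refine Finset.sum_congr rfl fun k _ ↦ Finset.sum_congr rfl fun i _ ↦ ?_
          rw [gUp_symm g q i k]; ring
      _ = p j := by simp [sum_gUp_mul_gLow g he hq]
  rw [hamField_hamField_natHam_rep g he hV hG hq, natHam_eq_velocity]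
  have : ∑ i, ∑ j, velocity g e q p i * velocity g e q p j * hessian g e G i j q
      = -K * rep e G q * ∑ j, velocity g e q p j * p j := by
    rw [Finset.sum_comm, Finset.mul_sum]
    refine Finset.sum_congr rfl fun j _ ↦ ?_
    rw [← hlow j, Finset.mul_sum, Finset.mul_sum]
    refine Finset.sum_congr rfl fun i _ ↦ ?_
    rw [eq_neg_of_add_eq_zero_left (hK e he q hq i j)]
    simp only [rep]
    ring
  rw [this]
  ring

/-- A nondegenerate kinetic energy does not vanish identically. -/
lemma exists_natHam_sub_ne_zero (hn : 1 ≤ n) (he : e ∈ charts n Q) (V : Q → ℝ) {q : E n}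
    (hq : q ∈ e.target) : ∃ p : E n, natHam g e V q p - rep e V q ≠ 0 := by
  by_contra! H
  have hquad (p : E n) : ∑ i, velocity g e q p i * p i = 0 := by
    have := H p
    rw [natHam_eq_velocity] at this
    linarith
  -- by polarization the form `g^{ij}` vanishes, contrary to its invertibility
  have hbil (i j : Fin n) : gUp g e q i j = 0 := by
    have h1 := hquad (EuclideanSpace.single i 1)
    have h2 := hquad (EuclideanSpace.single j 1)
    have h3 := hquad (EuclideanSpace.single i 1 + EuclideanSpace.single j 1)
    simp [velocity, mul_add, Finset.sum_add_distrib] at h1 h2 h3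
    have := gUp_symm g q i j (e := e)
    linarith
  have := sum_gUp_mul_gLow g he hq ⟨0, hn⟩ ⟨0, hn⟩
  simp [hbil] at this

end Geodesic

/-! ### Extensions -/

section Extension

variable {n : ℕ} {Q : Type*} [TopologicalSpace Q] [ChartedSpace (E n) Q]
  [IsManifold (𝓡 n) ∞ Q] {g : PseudoRiemannianMetric n Q}

/-- If `X_L G` vanishes identically, `G` is locally constant, so that a solution of
`∇ᵢ∇ⱼ G + K gᵢⱼ G = 0` has `K G = 0`. -/
lemma potentialCondition_of_hamField_eq_zero (hn : 1 ≤ n) {V G : Q → ℝ} {m : ℕ} {c : ℝ}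
    (hK : SolvesHessianEq g (m * c) G)
    (h : ∀ e ∈ charts n Q, ∀ q ∈ e.target, ∀ p,
      hamField (natHam g e V) (fun q _ ↦ rep e G q) q p = 0) :
    PotentialCondition g V m c 0 G := by
  intro e he q hq
  have hpd {x : E n} (hx : x ∈ e.target) (i : Fin n) : pd i (rep e G) x = 0 := by
    refine congrFun (eq_zero_of_sum_gUp_mul g he hx (w := fun i ↦ pd i (rep e G) x) fun j ↦ ?_) i
    have := h e he x hx (EuclideanSpace.single j 1)
    rw [hamField_natHam_rep g he V G hx] at this
    simpa [velocity, Pi.single_apply, gUp_symm g x _ j] using this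
  have hgrad : gradDot g e V G q = 0 := by simp [gradDot, hpd hq]
  have hKG : m * c * G (e.symm q) = 0 := by
    by_contra hne
    have hlow (i j : Fin n) : gLow g e q i j = 0 := by
      have := hK e he q hq i j
      have h0 : hessian g e G i j q = 0 := by
        rw [hessian, pd_congr_of_eqOn e.open_target hq fun x hx ↦ hpd hx j]
        simp [hpd hq]
      rw [h0, zero_add, mul_right_comm] at this
      exact (mul_eq_zero.1 this).resolve_left hne
    have := sum_gUp_mul_gLow g he hq ⟨0, hn⟩ ⟨0, hn⟩
    simp [hlow] at this
  rw [hgrad]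
  linear_combination (-2 * V (e.symm q)) * hKG

/-- Necessity of the potential condition, with `L₀ = -f'/(2αγ)` at a point with `αγ ≠ 0`. -/
lemma exists_potentialCondition_of_admitsExtension (hn : 1 ≤ n) {V G : Q → ℝ}
    (hV : ContMDiff (𝓡 n) 𝓘(ℝ, ℝ) ∞ V) (hG : ContMDiff (𝓡 n) 𝓘(ℝ, ℝ) ∞ G)
    {m : ℕ} (hm : 1 ≤ m) {c : ℝ} (hK : SolvesHessianEq g (m * c) G)
    (hext : AdmitsExtension g V m G) : ∃ L₀ : ℝ, PotentialCondition g V m c L₀ G := by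
  obtain ⟨N, α, f, γ, hN, -, -, hα, hf, hγ, ⟨u₁, hu₁, hαu₁⟩, hint⟩ := hext
  have diff {φ : ℝ → ℝ} (hφ : ContDiffOn ℝ ∞ φ N) {u : ℝ} (hu : u ∈ N) : DifferentiableAt ℝ φ u :=
    (hφ.contDiffAt (hN.mem_nhds hu)).differentiableAt (by simp)
  obtain ⟨k, rfl⟩ : ∃ k, m = k + 1 := ⟨m - 1, by omega⟩
  have hm0 : (k : ℝ) + 1 ≠ 0 := by positivity
  push_cast at hK
  -- the coefficients of `p_u^{k+1}` and `p_u^k` in `X_H U^{k+1} G = 0`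
  have coeffs (e) (he : e ∈ charts n Q) (u) (hu : u ∈ N) (q) (hq : q ∈ e.target) (p : E n) :=
    leading_coeffs_eq_zero (b := γ u) (A := α u + (k + 1) * deriv γ u) (B := α u * γ u)
      (C := (k + 1) * (deriv α u * natHam g e V q p + deriv f u))
      (D := fun j ↦ (hamField (natHam g e V))^[j] (fun q _ ↦ rep e G q) q p) (m := k)
      fun a ↦ (hamFieldExt_powU e.open_target (smoothPhase_natHam g he hV)
        (smoothPhase_of_contDiffOn (contDiffOn_rep he hG)) (diff hα hu) (diff hf hu) (diff hγ hu)
        k a hq p fun _ ↦ rfl).symm.trans (hint e he u hu a q hq p)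
  by_cases hconst : ∀ e ∈ charts n Q, ∀ q ∈ e.target, ∀ p,
      hamField (natHam g e V) (fun q _ ↦ rep e G q) q p = 0
  · exact ⟨0, potentialCondition_of_hamField_eq_zero hn (by push_cast; exact hK) hconst⟩
  push Not at hconst
  obtain ⟨e₁, he₁, q₁, hq₁, p₁, hne⟩ := hconst
  have hαγ {u} (hu : u ∈ N) : α u + (k + 1) * deriv γ u = 0 :=
    (mul_eq_zero.1 (coeffs e₁ he₁ u hu q₁ hq₁ p₁).1).resolve_right hne
  have second {e} (he : e ∈ charts n Q) {u} (hu : u ∈ N) {q} (hq : q ∈ e.target) (p : E n) :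
      α u * γ u * (-2 * ((k + 1) * c) * (natHam g e V q p - rep e V q) * rep e G q
        - gradDot g e V G q)
        = (k + 1) * (deriv α u * natHam g e V q p + deriv f u) * rep e G q := by
    rw [← hamField_hamField_of_solvesHessianEq g he hV hG hK hq p]
    exact (coeffs e he u hu q hq p).2 (hαγ hu)
  -- near a point with `α ≠ 0`, `γ` is not constant, hence not zero
  obtain ⟨u₀, hu₀, hαγ₀⟩ : ∃ u ∈ N, α u * γ u ≠ 0 := by
    by_contra! H
    have hev : γ =ᶠ[nhds u₁] fun _ ↦ 0 := by
      filter_upwards [hN.mem_nhds hu₁, (diff hα hu₁).continuousAt.eventually_ne hαu₁] with u hu hαu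
      exact (mul_eq_zero.1 (H u hu)).resolve_left hαu
    have := hαγ hu₁
    rw [hev.deriv_eq] at this
    simp at this
    exact hαu₁ this
  -- `G` does not vanish identically, as otherwise `X_L G = 0`
  obtain ⟨e₂, he₂, q₂, hq₂, hG₂⟩ : ∃ e ∈ charts n Q, ∃ q ∈ e.target, rep e G q ≠ 0 := by
    by_contra! H
    refine hne ?_
    rw [hamField_natHam_rep g he₁ V G hq₁]
    refine Finset.sum_eq_zero fun i _ ↦ ?_
    rw [pd_congr_of_eqOn e₁.open_target hq₁ fun x hx ↦ H e₁ he₁ x hx, pd_const, mul_zero]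
  obtain ⟨p₂, hp₂⟩ := exists_natHam_sub_ne_zero g hn he₂ V hq₂
  have hα' : deriv α u₀ + 2 * c * (α u₀ * γ u₀) = 0 := by
    have h0 := second he₂ hu₀ hq₂ 0
    have h2 := second he₂ hu₀ hq₂ p₂
    have hV0 : natHam g e₂ V q₂ 0 = rep e₂ V q₂ := by simp [natHam]
    rw [hV0] at h0
    have : (k + 1) * (natHam g e₂ V q₂ p₂ - rep e₂ V q₂) * rep e₂ G q₂
        * (deriv α u₀ + 2 * c * (α u₀ * γ u₀)) = 0 := by linear_combination h0 - h2
    exact (mul_eq_zero.1 this).resolve_left (mul_ne_zero (mul_ne_zero hm0 hp₂) hG₂)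
  refine ⟨-(deriv f u₀ / (2 * (α u₀ * γ u₀))), fun e he q hq ↦ ?_⟩
  have h0 := second he hu₀ hq 0
  have hV0 : natHam g e V q 0 = rep e V q := by simp [natHam]
  rw [hV0, eq_neg_of_add_eq_zero_left hα'] at h0
  change gradDot g e V G q - 2 * ((k + 1 : ℕ) : ℝ) * (c * rep e V q + _) * rep e G q = 0
  refine (mul_eq_zero.1 (?_ : (α u₀ * γ u₀) * _ = 0)).resolve_left hαγ₀
  have hdiv : α u₀ * γ u₀ * (deriv f u₀ / (2 * (α u₀ * γ u₀))) = deriv f u₀ / 2 := by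
    generalize α u₀ * γ u₀ = s at hαγ₀ ⊢
    field_simp
  push_cast
  linear_combination -h0 + 2 * (k + 1) * rep e G q * hdiv

/-- If `α = -mγ'`, `α' = -2cαγ` and `f' = -2L₀αγ` on an open interval, the potential condition makes
`Uᵐ(G)` a first integral: `αγ X_L² G = m(α'L + f')G`, and `X_L` commutes with `L`. -/
lemma isFirstIntegralPowU_of_potentialCondition {V G : Q → ℝ}
    (hV : ContMDiff (𝓡 n) 𝓘(ℝ, ℝ) ∞ V) (hG : ContMDiff (𝓡 n) 𝓘(ℝ, ℝ) ∞ G)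
    {m : ℕ} (hm : 1 ≤ m) {c L₀ : ℝ} (hK : SolvesHessianEq g (m * c) G)
    (hpot : PotentialCondition g V m c L₀ G) {N : Set ℝ} {α f γ : ℝ → ℝ}
    (hγ : ∀ u ∈ N, HasDerivAt γ (-(α u / m)) u)
    (hα : ∀ u ∈ N, HasDerivAt α (-2 * c * (α u * γ u)) u)
    (hf : ∀ u ∈ N, HasDerivAt f (-2 * L₀ * (α u * γ u)) u) :
    IsFirstIntegralPowU g V m G N α f γ := by
  intro e he u hu a q hq p
  obtain ⟨k, rfl⟩ : ∃ k, m = k + 1 := ⟨m - 1, by omega⟩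
  have hL := smoothPhase_natHam g he hV
  have hG' := smoothPhase_of_contDiffOn (contDiffOn_rep he hG)
  have hsq (q) (hq : q ∈ e.target) (p : E n) :
      hamField (natHam g e V) (hamField (natHam g e V) (fun q _ ↦ rep e G q)) q p
        = (-2 * ((k + 1) * c) * natHam g e V q p + -2 * ((k + 1) * L₀)) * rep e G q := by
    have h1 := hpot e he q hq
    change gradDot g e V G q - 2 * _ * (c * rep e V q + L₀) * rep e G q = 0 at h1
    rw [hamField_hamField_of_solvesHessianEq g he hV hG hK hq]
    push_cast at h1 ⊢
    linear_combination -h1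
  rw [hamFieldExt_powU e.open_target hL hG' (hα u hu).differentiableAt (hf u hu).differentiableAt
    (hγ u hu).differentiableAt k a hq p fun _ ↦ rfl, (hγ u hu).deriv, (hα u hu).deriv,
    (hf u hu).deriv]
  have h2 := binShift_shift_two (a := a) (b := γ u) (A := α u * γ u)
    (B := (k + 1) * (-2 * c * (α u * γ u) * natHam g e V q p + -2 * L₀ * (α u * γ u)))
    (D := fun j ↦ (hamField (natHam g e V))^[j] (fun q _ ↦ rep e G q) q p)
    (fun j ↦ by
      rw [iterate_hamField_add_two e.open_target hL hG' hsq j hq p]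
      ring) k 0
  have hk : (k : ℝ) + 1 ≠ 0 := by positivity
  -- the coefficient of `p_u` vanishes since `α = -mγ'`
  push_cast
  rw [mul_neg, mul_div_cancel₀ _ hk]
  linear_combination h2

/-- Sufficiency of the potential condition, by explicit extensions on the half-line `u > 0`. -/
lemma admitsExtension_of_potentialCondition {V G : Q → ℝ}
    (hV : ContMDiff (𝓡 n) 𝓘(ℝ, ℝ) ∞ V) (hG : ContMDiff (𝓡 n) 𝓘(ℝ, ℝ) ∞ G)
    {m : ℕ} (hm : 1 ≤ m) {c L₀ : ℝ} (hK : SolvesHessianEq g (m * c) G)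
    (hpot : PotentialCondition g V m c L₀ G) : AdmitsExtension g V m G := by
  have hm0 : (m : ℝ) ≠ 0 := by positivity
  by_cases hc : c = 0
  · -- `γ'` is constant
    subst hc
    refine ⟨Set.Ioi 0, fun _ ↦ 1, fun u ↦ L₀ / m * u ^ 2, fun u ↦ -(1 / m) * u, isOpen_Ioi,
      Set.nonempty_Ioi, isPreconnected_Ioi, by fun_prop, by fun_prop, by fun_prop,
      ⟨1, by simp, one_ne_zero⟩,
      isFirstIntegralPowU_of_potentialCondition hV hG hm hK hpot (fun u _ ↦ ?_) (fun u _ ↦ ?_)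
        (fun u _ ↦ ?_)⟩
    · exact ((hasDerivAt_id u).const_mul (-(1 / (m : ℝ)))).congr_deriv (by simp)
    · exact (hasDerivAt_const u (1 : ℝ)).congr_deriv (by ring)
    · exact ((hasDerivAt_pow 2 u).const_mul (L₀ / m)).congr_deriv (by push_cast; ring)
  · -- `γ' = -cγ²`, `α = mcγ²`, `f = mL₀γ²`
    have hsm : ContDiffOn ℝ ∞ (fun u : ℝ ↦ u⁻¹) (Set.Ioi 0) :=
      contDiffOn_id.inv fun u hu ↦ (Set.mem_Ioi.1 hu).ne'
    have hd {u : ℝ} (hu : u ∈ Set.Ioi (0 : ℝ)) := hasDerivAt_inv (Set.mem_Ioi.1 hu).ne'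
    refine ⟨Set.Ioi 0, fun u ↦ m / c * u⁻¹ ^ 2, fun u ↦ m * L₀ / c ^ 2 * u⁻¹ ^ 2,
      fun u ↦ 1 / c * u⁻¹, isOpen_Ioi,
      Set.nonempty_Ioi, isPreconnected_Ioi, contDiffOn_const.mul (hsm.pow 2),
      contDiffOn_const.mul (hsm.pow 2), contDiffOn_const.mul hsm,
      ⟨1, by simp, by simp [hc, hm0]⟩,
      isFirstIntegralPowU_of_potentialCondition hV hG hm hK hpot (fun u hu ↦ ?_) (fun u hu ↦ ?_)
        (fun u hu ↦ ?_)⟩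
    · refine ((hd hu).const_mul (1 / c)).congr_deriv ?_
      field_simp
    · refine (((hd hu).pow 2).const_mul (m / c)).congr_deriv ?_
      have : u ≠ 0 := (Set.mem_Ioi.1 hu).ne'
      simp only [Nat.add_one_sub_one, pow_one]
      push_cast
      field_simp
    · refine (((hd hu).pow 2).const_mul (m * L₀ / c ^ 2)).congr_deriv ?_
      have : u ≠ 0 := (Set.mem_Ioi.1 hu).ne'
      simp only [Nat.add_one_sub_one, pow_one]
      push_cast
      field_simp

end Extension

end ExtHam

theorem mainTheorem2 {n : ℕ} (hn : 1 ≤ n) {Q : Type*} [TopologicalSpace Q]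
    [ChartedSpace (ExtHam.E n) Q] [IsManifold (𝓡 n) ∞ Q]
    (g : ExtHam.PseudoRiemannianMetric n Q) (V G : Q → ℝ)
    (hV : ContMDiff (𝓡 n) 𝓘(ℝ, ℝ) ∞ V) (hG : ContMDiff (𝓡 n) 𝓘(ℝ, ℝ) ∞ G)
    (m : ℕ) (hm : 1 ≤ m) (c : ℝ) :
    (ExtHam.AdmitsExtension g V m G ∧ ExtHam.IsCompleteSolution g (m * c) G) ↔
      (ExtHam.HasConstantCurvature g (m * c) ∧
        ExtHam.SolvesHessianEq g (m * c) G ∧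
        ∃ L₀ : ℝ, ExtHam.PotentialCondition g V m c L₀ G) := by
  unfold ExtHam.IsCompleteSolution
  rw [ExtHam.hessianEqIntegrable_iff]
  constructor
  · rintro ⟨hext, hK, hcurv⟩
    exact ⟨hcurv, hK,
      ExtHam.exists_potentialCondition_of_admitsExtension hn hV hG hm hK hext⟩
  · rintro ⟨hcurv, hK, L₀, hpot⟩
    exact ⟨ExtHam.admitsExtension_of_potentialCondition hV hG hm hK hpot, hK, hcurv⟩
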